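/- **Theorem.** Let $n\ge 0$ be an integer, $\hbar>0$, $\varkappa\in\mathbb R$. Write $\hat z=(\hat p,x)$, $\hat p=-i\hbar\partial_x$, $x\in\mathbb R^n$, and $J=\begin{pmatrix}0&-\mathbb I\\ \mathbb I&0\end{pmatrix}$. Let $\mathcal H_{zz},W_{zz},W_{zw},W_{ww}$ be continuous functions of $t\in\mathbb R$ with values in the real $2n\times2n$ matrices, $\mathcal H_{zz},W_{zz},W_{ww}$ symmetric, and let $\mathcal H_z:\mathbb R\to\mathbb R^{2n}$ be continuous; they are the coefficients of the nonlocal Gross–Pitaevskii equation $\{-i\hbar\partial_t+\mathcal H(\hat z,t)+\varkappa\int\Psi^*(y,t)V(\hat z,\hat w,t)\Psi(y,t)\,dy\}\Psi=0$ (with $\hat w=(-i\hbar\partial_y,y)$), where $\mathcal H(\hat z,t)=\frac12\langle\hat z,\mathcal H_{zz}\hat z\rangle+\langle\mathcal H_z,\hat z\rangle$ and $V(\hat z,\hat w,t)=\frac12\langle\hat z,W_{zz}\hat z\rangle+\langle\hat z,W_{zw}\hat w\rangle+\frac12\langle\hat w,W_{ww}\hat w\rangle$. *Moments and trajectories.*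 $\mathcal P_\hbar^0$ is the class of functions $\psi(x)=\exp\{\frac i\hbar(S_0+\langle P_0,x-X_0\rangle)\}\,\varphi_0\big((x-X_0)/\sqrt\hbar\big)$ with $S_0\in\mathbb R$, $P_0,X_0\in\mathbb R^n$, $\varphi_0\in\mathcal S(\mathbb R^n)$. For such $\psi$ let $\langle\hat A\rangle_\psi=\langle\psi|\hat A|\psi\rangle/\|\psi\|^2$ (taken to be $0$ for $\psi=0$), $\tilde\varkappa=\varkappa\|\psi\|^2$ with the $L_2$ norm, and $\mathfrak g_0(\psi)=(z_\psi,\Delta_\psi)$, where $z_\psi=\langle\hat z\rangle_\psi$ and $(\Delta_\psi)_{jk}=\frac12\langle\Delta\hat z_j\Delta\hat z_k+\Delta\hat z_k\Delta\hat z_j\rangle_\psi$, $\Delta\hat z=\hat z-z_\psi$. Put $\mathfrak H_{zz}=\mathcal H_{zz}+\tilde\varkappa W_{zz}$. If $\psi$ is given at time $s$, let $\mathfrak g(t)=(z(t),\Delta(t))$, $z=(P,X)$, be the solution, with $\mathfrak g(s)=\mathfrak g_0(\psi)$, of the Hamilton–Ehrenfest system $$\dot z=J\{\mathcal H_z+[\mathcal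 H_{zz}+\tilde\varkappa(W_{zz}+W_{zw})]z\},\qquad \dot\Delta=J\mathfrak H_{zz}\Delta-\Delta\mathfrak H_{zz}J .$$ *Green function.* Let $\mathcal A(t,s)=\begin{pmatrix}\lambda_4^\top&-\lambda_2^\top\\-\lambda_3^\top&\lambda_1^\top\end{pmatrix}(t,s)$ be the solution of $\partial_t\mathcal A=J\mathfrak H_{zz}(t)\mathcal A$, $\mathcal A(s,s)=\mathbb I$, and let $S(t)=\int_0^t\{\langle P,\dot X\rangle-\mathfrak H\}\,d\tau$ with $\mathfrak H=\frac12\langle z,[\mathcal H_{zz}+\tilde\varkappa(W_{zz}+2W_{zw}+W_{ww})]z\rangle+\langle\mathcal H_z,z\rangle+\frac12\tilde\varkappa\,\mathrm{tr}(W_{ww}\Delta)$. For $\det\lambda_3(t,s)\ne0$, with $\Delta x=x-X(t)$, $\Delta y=y-X(s)$ and $\lambda_k=\lambda_k(t,s)$, put $$G_\varkappa(x,y,t,s,\mathfrak g(t),\mathfrak g(s))=\frac{1}{\sqrt{\det(-i2\pi\hbar\lambda_3)}}\exp\Big\{\frac i\hbar\Big[S(t)-S(s)+\langle P(t),\Delta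 x\rangle-\langle P(s),\Delta y\rangle-\tfrac12\langle\Delta y,\lambda_1\lambda_3^{-1}\Delta y\rangle+\langle\Delta x,\lambda_3^{-1}\Delta y\rangle-\tfrac12\langle\Delta x,\lambda_3^{-1}\lambda_4\Delta x\rangle\Big]\Big\}.$$ The branch of the root is the one for which $G_\varkappa\to\delta(x-y)$ as $t\to s$, continued in $t$: it is $\lim_{\varepsilon\to0+}R_\varepsilon(t,s)$, where $R_\varepsilon(\cdot,s)$ is the continuous square root of the nowhere vanishing function $t\mapsto\det\{-i2\pi\hbar(\lambda_3+i\varepsilon(\lambda_1+\lambda_4)-\varepsilon^2\lambda_2)(t,s)\}$ that is positive at $t=s$. *Evolution operators.* For $\psi$ given at time $s$, with $\tilde\varkappa$ and $\mathfrak g$ determined by $\psi$ as above ($\mathfrak g(s)=\mathfrak g_0(\psi)$), let $$\hat U_\varkappa(t,s,\psi)(x)=\int_{\mathbb R^n}G_\varkappa(x,y,t,s,\mathfrak g(t),\mathfrak g(s))\,\psi(y)\,dy .$$ For $\phi$ given at time $t$, with $\tilde\varkappa=\varkappa\|\phi\|^2$ and $\mathfrak g$ determined by $\mathfrak g(t)=\mathfrak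 g_0(\phi)$, let $$\hat U_\varkappa^{-1}(t,s,\phi)(x)=\int_{\mathbb R^n}G_\varkappa(x,y,s,t,\mathfrak g(s),\mathfrak g(t))\,\phi(y)\,dy .$$ For $t=s$ the kernel is $\delta(x-y)$, so both operators are the identity. *Claim.* $\hat U_\varkappa^{-1}(t,s,\cdot)$ is a left inverse of $\hat U_\varkappa(t,s,\cdot)$: for every $\psi\in\mathcal P_\hbar^0$ and all $t,s\in\mathbb R$ such that $t=s$ or $\det\lambda_3(t,s)\neq0$ (with $\lambda_3$ formed with $\tilde\varkappa=\varkappa\|\psi\|^2$), $$\hat U_\varkappa^{-1}\big(t,s,\hat U_\varkappa(t,s,\psi)\big)(x)=\psi(x)\qquad\text{for all }x\in\mathbb R^n .$$ -/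

import Mathlib

open MeasureTheory Filter Topology Matrix

namespace NonlocalGPE

noncomputable section

/-- Vectors and matrices on the phase space `ℝ^{2n}`; the coordinates are ordered as
`z = (p, x)`, so that `Sum.inl j` is the momentum `p_j` and `Sum.inr j` the position `x_j`. -/
abbrev PhaseVec (n : ℕ) : Type := Fin n ⊕ Fin n → ℝ

abbrev PhaseMat (n : ℕ) : Type := Matrix (Fin n ⊕ Fin n) (Fin n ⊕ Fin n) ℝ

/-- The coefficients of the two quadratic operators
`H(ẑ, t) = ½⟨ẑ, H_zz(t) ẑ⟩ + ⟨H_z(t), ẑ⟩` and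
`V(ẑ, ŵ, t) = ½⟨ẑ, W_zz(t) ẑ⟩ + ⟨ẑ, W_zw(t) ŵ⟩ + ½⟨ŵ, W_ww(t) ŵ⟩`:
real, continuous in time, with the symmetry that makes both operators self-adjoint. -/
structure Coeffs (n : ℕ) where
  Hzz : ℝ → PhaseMat n
  Hz : ℝ → PhaseVec n
  Wzz : ℝ → PhaseMat n
  Wzw : ℝ → PhaseMat n
  Www : ℝ → PhaseMat n
  continuous_Hzz : Continuous Hzz
  continuous_Hz : Continuous Hz
  continuous_Wzz : Continuous Wzz
  continuous_Wzw : Continuous Wzw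
  continuous_Www : Continuous Www
  isSymm_Hzz : ∀ t, (Hzz t).IsSymm
  isSymm_Wzz : ∀ t, (Wzz t).IsSymm
  isSymm_Www : ∀ t, (Www t).IsSymm

variable {n : ℕ}

/-! ### Trajectory concentrated functions and their moments -/

/-- The class of trajectory concentrated functions at a fixed time, for a fixed `ħ`:
`ψ(x) = exp{(i/ħ)(S₀ + ⟨P₀, x - X₀⟩)} φ₀((x - X₀)/√ħ)` with `φ₀` a Schwartz function. -/
def tcfClass (n : ℕ) (ħ : ℝ) : Set (EuclideanSpace ℝ (Fin n) → ℂ) :=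
  {ψ | ∃ (S₀ : ℝ) (P₀ X₀ : EuclideanSpace ℝ (Fin n))
      (φ₀ : SchwartzMap (EuclideanSpace ℝ (Fin n)) ℂ),
      ∀ x, ψ x = Complex.exp (Complex.I / ħ * ((S₀ + inner ℝ P₀ (x - X₀) : ℝ) : ℂ)) *
        φ₀ ((Real.sqrt ħ)⁻¹ • (x - X₀))}

/-- `‖ψ‖²`, the squared norm in `L²(ℝⁿ)`. -/
def normSq (ψ : EuclideanSpace ℝ (Fin n) → ℂ) : ℝ := ∫ x, ‖ψ x‖ ^ 2

/-- The operators `ẑ = (p̂, x)`, `p̂_j = -iħ ∂/∂x_j`. -/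
def zOp (ħ : ℝ) : Fin n ⊕ Fin n → (EuclideanSpace ℝ (Fin n) → ℂ) →
    EuclideanSpace ℝ (Fin n) → ℂ
  | Sum.inl j, ψ => fun x => -Complex.I * ħ * fderiv ℝ ψ x (EuclideanSpace.single j 1)
  | Sum.inr j, ψ => fun x => (x j : ℂ) * ψ x

/-- The mean value `⟨Â⟩ = ⟨ψ|Â|ψ⟩ / ‖ψ‖²`. It is applied to symmetric operators only, whose
mean values are real, and is therefore taken as a real number. -/
def mean (A : (EuclideanSpace ℝ (Fin n) → ℂ) → EuclideanSpace ℝ (Fin n) → ℂ)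
    (ψ : EuclideanSpace ℝ (Fin n) → ℂ) : ℝ :=
  (∫ x, star (ψ x) * A ψ x).re / normSq ψ

/-- The first moments `z_ψ = (⟨p̂⟩, ⟨x⟩)`. -/
def zMean (ħ : ℝ) (ψ : EuclideanSpace ℝ (Fin n) → ℂ) : PhaseVec n :=
  fun k => mean (zOp ħ k) ψ

/-- The centred operators `Δẑ_k = ẑ_k - z_k`. -/
def dzOp (ħ : ℝ) (z : PhaseVec n) (k : Fin n ⊕ Fin n)
    (ψ : EuclideanSpace ℝ (Fin n) → ℂ) : EuclideanSpace ℝ (Fin n) → ℂ :=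
  fun x => zOp ħ k ψ x - (z k : ℂ) * ψ x

/-- The second centred moments `½⟨Δẑ_j Δẑ_k + Δẑ_k Δẑ_j⟩`. -/
def covMean (ħ : ℝ) (ψ : EuclideanSpace ℝ (Fin n) → ℂ) : PhaseMat n :=
  Matrix.of fun j k => 1 / 2 * mean (fun φ x =>
    dzOp ħ (zMean ħ ψ) j (dzOp ħ (zMean ħ ψ) k φ) x +
    dzOp ħ (zMean ħ ψ) k (dzOp ħ (zMean ħ ψ) j φ) x) ψ

/-- The moments `𝔤₀(ψ) = ⟨ψ|ĝ|ψ⟩ / ‖ψ‖²` of first and second order. -/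
def moments (ħ : ℝ) (ψ : EuclideanSpace ℝ (Fin n) → ℂ) : PhaseVec n × PhaseMat n :=
  (zMean ħ ψ, covMean ħ ψ)

/-! ### The Hamilton–Ehrenfest system and the system in variations

Below `κt` stands for the parameter `ϰ‖ψ‖²`. -/

/-- `𝔥_zz(t) = H_zz(t) + κt W_zz(t)`. -/
def Coeffs.hzz (D : Coeffs n) (κt t : ℝ) : PhaseMat n := D.Hzz t + κt • D.Wzz t

/-- `g = (z, Δ)` solves the Hamilton–Ehrenfest system
`ż = J{H_z + [H_zz + κt(W_zz + W_zw)]z}`, `Δ̇ = J 𝔥_zz Δ - Δ 𝔥_zz J` on the whole time axis. -/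
def IsHESSolution (D : Coeffs n) (κt : ℝ) (g : ℝ → PhaseVec n × PhaseMat n) : Prop :=
  (∀ t k, HasDerivAt (fun τ => (g τ).1 k)
    ((Matrix.J (Fin n) ℝ *ᵥ
      (D.Hz t + (D.Hzz t + κt • (D.Wzz t + D.Wzw t)) *ᵥ (g t).1)) k) t) ∧
  (∀ t j k, HasDerivAt (fun τ => (g τ).2 j k)
    ((Matrix.J (Fin n) ℝ * D.hzz κt t * (g t).2 -
      (g t).2 * D.hzz κt t * Matrix.J (Fin n) ℝ) j k) t)

/-- The solution of the Hamilton–Ehrenfest system (a linear system) with `g(s) = g₀`. -/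
def hesSolution (D : Coeffs n) (κt s : ℝ) (g₀ : PhaseVec n × PhaseMat n) :
    ℝ → PhaseVec n × PhaseMat n :=
  Classical.epsilon fun g => IsHESSolution D κt g ∧ g s = g₀

/-- The solution `𝒜(·, s)` of the system in variations `𝒜̇ = J 𝔥_zz 𝒜`, `𝒜(s, s) = 1`. -/
def matricant (D : Coeffs n) (κt t s : ℝ) : PhaseMat n :=
  (Classical.epsilon fun A : ℝ → PhaseMat n =>
    (∀ τ j k, HasDerivAt (fun σ => A σ j k)
      ((Matrix.J (Fin n) ℝ * D.hzz κt τ * A τ) j k) τ) ∧ A s = 1) t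

/-! The blocks of `𝒜(t, s) = [[λ₄ᵀ, -λ₂ᵀ], [-λ₃ᵀ, λ₁ᵀ]]`. -/

def lam1 (D : Coeffs n) (κt t s : ℝ) : Matrix (Fin n) (Fin n) ℝ :=
  (matricant D κt t s).toBlocks₂₂ᵀ

def lam2 (D : Coeffs n) (κt t s : ℝ) : Matrix (Fin n) (Fin n) ℝ :=
  -(matricant D κt t s).toBlocks₁₂ᵀ

def lam3 (D : Coeffs n) (κt t s : ℝ) : Matrix (Fin n) (Fin n) ℝ :=
  -(matricant D κt t s).toBlocks₂₁ᵀ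

def lam4 (D : Coeffs n) (κt t s : ℝ) : Matrix (Fin n) (Fin n) ℝ :=
  (matricant D κt t s).toBlocks₁₁ᵀ

/-! ### The Green function -/

/-- The scalar part of the Hamiltonian of the linear associated Schrödinger equation,
`𝔥 = ½⟨z, [H_zz + κt(W_zz + 2W_zw + W_ww)]z⟩ + ⟨H_z, z⟩ + ½ κt tr(W_ww Δ)`. -/
def scalarHam (D : Coeffs n) (κt t : ℝ) (g : PhaseVec n × PhaseMat n) : ℝ :=
  1 / 2 * (g.1 ⬝ᵥ ((D.Hzz t + κt • (D.Wzz t + (2 : ℝ) • D.Wzw t + D.Www t)) *ᵥ g.1)) +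
    D.Hz t ⬝ᵥ g.1 + 1 / 2 * κt * (D.Www t * g.2).trace

/-- The action `S(t) = ∫₀ᵗ {⟨P, Ẋ⟩ - 𝔥} dτ` along a trajectory `g = ((P, X), Δ)`. -/
def action (D : Coeffs n) (κt : ℝ) (g : ℝ → PhaseVec n × PhaseMat n) (t : ℝ) : ℝ :=
  ∫ τ in (0 : ℝ)..t,
    (∑ j, (g τ).1 (Sum.inl j) * deriv (fun σ => (g σ).1 (Sum.inr j)) τ -
      scalarHam D κt τ (g τ))

/-- The square root of a nowhere vanishing `C¹` function `f`, continued along the time axis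
from its principal value at `s`. -/
def sqrtAlong (f : ℝ → ℂ) (s t : ℝ) : ℂ :=
  f s ^ (1 / 2 : ℂ) * Complex.exp (1 / 2 * ∫ τ in s..t, logDeriv f τ)

/-- `det(-i2πħ(λ₃ + iε(λ₁ + λ₄) - ε²λ₂)(t, s))`, the regularization of `det(-i2πħλ₃(t, s))`
that arises when the Green function of the equation with the quadratic Hamiltonian
`½⟨ẑ, 𝔥_zz ẑ⟩` is smeared in `x` and in `y` with the Gaussian approximation
`(2πħε)^{-n/2} exp(-|x|²/(2ħε))` of the delta function. For `ε > 0` it has no zeros, and for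
`t = s` it is equal to `(4πħε)ⁿ > 0`. -/
def regDet (D : Coeffs n) (ħ κt ε t s : ℝ) : ℂ :=
  ((-Complex.I * 2 * Real.pi * ħ) •
    ((lam3 D κt t s).map Complex.ofReal +
      (Complex.I * ε) • (lam1 D κt t s + lam4 D κt t s).map Complex.ofReal -
      ((ε : ℂ) ^ 2) • (lam2 D κt t s).map Complex.ofReal)).det

/-- The branch of `√det(-i2πħλ₃(t, s))` that belongs to the Green function, that is, to the
kernel which tends to `δ(x - y)` as `t → s`: the regularized determinant is continued in time
from its positive value at `t = s`, and the regularization is removed. -/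
def sqrtDet (D : Coeffs n) (ħ κt t s : ℝ) : ℂ :=
  limUnder (𝓝[>] (0 : ℝ)) fun ε : ℝ => sqrtAlong (fun τ => regDet D ħ κt ε τ s) s t

/-- The real phase of the Green function, with `Δx = x - X(t)` and `Δy = y - X(s)`. -/
def greenPhase (D : Coeffs n) (κt : ℝ) (g : ℝ → PhaseVec n × PhaseMat n) (t s : ℝ)
    (x y : EuclideanSpace ℝ (Fin n)) : ℝ :=
  let P : ℝ → Fin n → ℝ := fun τ j => (g τ).1 (Sum.inl j)
  let X : ℝ → Fin n → ℝ := fun τ j => (g τ).1 (Sum.inr j)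
  let Δx : Fin n → ℝ := fun j => x j - X t j
  let Δy : Fin n → ℝ := fun j => y j - X s j
  action D κt g t - action D κt g s + P t ⬝ᵥ Δx - P s ⬝ᵥ Δy
    - 1 / 2 * (Δy ⬝ᵥ ((lam1 D κt t s * (lam3 D κt t s)⁻¹) *ᵥ Δy))
    + Δx ⬝ᵥ ((lam3 D κt t s)⁻¹ *ᵥ Δy)
    - 1 / 2 * (Δx ⬝ᵥ (((lam3 D κt t s)⁻¹ * lam4 D κt t s) *ᵥ Δx))

/-- The Green function `G(x, y, t, s, g(t), g(s))` of the linear associated Schrödinger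
equation along the trajectory `g`, for `det λ₃(t, s) ≠ 0`. -/
def green (D : Coeffs n) (ħ κt : ℝ) (g : ℝ → PhaseVec n × PhaseMat n) (t s : ℝ)
    (x y : EuclideanSpace ℝ (Fin n)) : ℂ :=
  1 / sqrtDet D ħ κt t s * Complex.exp (Complex.I / ħ * (greenPhase D κt g t s x y : ℂ))

/-! ### The nonlinear evolution operator and its left inverse -/

/-- The trajectory `g(·, ℭ(ψ))` for a function `ψ` given at the time `s`: the solution of the
Hamilton–Ehrenfest system whose value at `s` is the moments of `ψ`, with `κt = ϰ‖ψ‖²`. -/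
def trajectory (D : Coeffs n) (ħ κ s : ℝ) (ψ : EuclideanSpace ℝ (Fin n) → ℂ) :
    ℝ → PhaseVec n × PhaseMat n :=
  hesSolution D (κ * normSq ψ) s (moments ħ ψ)

open Classical in
/-- The evolution operator `Û(t, s, ψ)`, where `ψ` is given at the time `s`. For `t = s` the
kernel is the delta function. -/
def evolution (D : Coeffs n) (ħ κ t s : ℝ) (ψ : EuclideanSpace ℝ (Fin n) → ℂ) :
    EuclideanSpace ℝ (Fin n) → ℂ :=
  fun x => if t = s then ψ x else
    ∫ y, green D ħ (κ * normSq ψ) (trajectory D ħ κ s ψ) t s x y * ψ y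

open Classical in
/-- The operator `Û⁻¹(t, s, φ)`, where `φ` is given at the time `t`: the integral operator
with the Green function in which the times are interchanged. -/
def evolutionInv (D : Coeffs n) (ħ κ t s : ℝ) (φ : EuclideanSpace ℝ (Fin n) → ℂ) :
    EuclideanSpace ℝ (Fin n) → ℂ :=
  fun x => if t = s then φ x else
    ∫ y, green D ħ (κ * normSq φ) (trajectory D ħ κ t φ) s t x y * φ y

end

end NonlocalGPE

/-! Once the parameter ϰ‖ψ‖² and the trajectory are frozen, the evolution operator is linear, with a
kernel quadratic in the exponent. It factors as (constant) · (multiplication by a quadratic phase) ·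
(linear change of variable) · (Fourier transform) · (multiplication by a quadratic phase), which is
`quadFourier`. The constant satisfies |1/√det(-i2πħλ₃)|² = (2πħ)⁻ⁿ|det λ₃|⁻¹, the Jacobian of the
change of variable (`norm_sq_inv_sqrtDet`), so Plancherel makes the operator isometric and Fourier
inversion makes the conjugate transposed kernel a left inverse (`integral_adjoint_quadFourier`).

Two things remain. First, exchanging the times along the same trajectory must conjugate and
transpose the kernel (`green_swap`). For the phase this follows from the symplecticity of the
matricant. For the root the sign matters: the determinant may vanish along the way, so the
comparison is made for the regularized determinant, which is Hermitian in (t, s), never zero, and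
positive on the diagonal; two continuous roots that agree at one point agree everywhere, and then ε
→ 0 (`sqrtDet_swap`).

Second, the backward operator computes its parameter and trajectory from φ = Ûψ, and these must be
the ones determined by ψ. The parameter agrees because the norm is preserved. For the trajectory,
integration by parts shows that the operator intertwines ẑ - z(t) with 𝒜(t, s)(ẑ - z(s))
(`dzSchwartz_greenOp`). Hence the first moments of φ are z(t) and the second are 𝒜Δ(s)𝒜ᵀ, which is
Δ(t) because both solve the same linear equation. Uniqueness for the Hamilton–Ehrenfest system then
identifies the two trajectories (`hesSolution_eq_of_isHESSolution`).

The trajectory and the matricant are defined by a choice operator, so global existence for linear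
equations is needed before their defining properties can be used. -/

namespace NonlocalGPE

/-! ### Linear differential equations: global existence by the Dyson series, and uniqueness. -/

section LinearODE

variable {E : Type*} [NormedAddCommGroup E] [NormedSpace ℝ E]

/-- The terms of the Dyson series of `u' = A u + b`, `u s = x₀`. -/
noncomputable def dysonTerm (A : ℝ → E →L[ℝ] E) (b : ℝ → E) (s : ℝ) (x₀ : E) : ℕ → ℝ → E
  | 0 => fun t => x₀ + ∫ τ in s..t, b τ
  | k + 1 => fun t => ∫ τ in s..t, A τ (dysonTerm A b s x₀ k τ)

variable {A : ℝ → E →L[ℝ] E} {b : ℝ → E} {s : ℝ} {x₀ : E}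

lemma hasDerivAt_dysonTerm_zero [CompleteSpace E] (hb : Continuous b) (t : ℝ) :
    HasDerivAt (dysonTerm A b s x₀ 0) (b t) t :=
  (hb.integral_hasStrictDerivAt s t).hasDerivAt.const_add x₀

lemma continuous_dysonTerm [CompleteSpace E] (hA : Continuous A) (hb : Continuous b) (k : ℕ) :
    Continuous (dysonTerm A b s x₀ k) := by
  induction k with
  | zero =>
    exact continuous_iff_continuousAt.2 fun t => (hasDerivAt_dysonTerm_zero hb t).continuousAt
  | succ k ih =>
    exact continuous_iff_continuousAt.2 fun t =>
      ((hA.clm_apply ih).integral_hasStrictDerivAt s t).hasDerivAt.continuousAt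

lemma hasDerivAt_dysonTerm_succ [CompleteSpace E] (hA : Continuous A) (hb : Continuous b) (k : ℕ) (t : ℝ) :
    HasDerivAt (dysonTerm A b s x₀ (k + 1)) (A t (dysonTerm A b s x₀ k t)) t :=
  ((hA.clm_apply (continuous_dysonTerm hA hb k)).integral_hasStrictDerivAt s t).hasDerivAt

/-- Each integration raises the power of |τ - s| by one and contributes the factor 1/(k + 1), whence
the factorial. The factorial makes the series converge on every ball, however large, so the solution
is global. -/
lemma norm_dysonTerm_le {T C K : ℝ} (hC : 0 ≤ C) (hK : 0 ≤ K)
    (hAK : ∀ t ∈ Metric.ball s T, ‖A t‖ ≤ K)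
    (h0 : ∀ t ∈ Metric.ball s T, ‖dysonTerm A b s x₀ 0 t‖ ≤ C) (k : ℕ) :
    ∀ t ∈ Metric.ball s T,
      ‖dysonTerm A b s x₀ k t‖ ≤ (K * |t - s|) ^ k / k.factorial * C := by
  induction k with
  | zero => simpa using h0
  | succ k ih =>
    intro t ht
    have hsub : Set.uIoc s t ⊆ Metric.ball s T := by
      have hs : s ∈ Metric.ball s T := by
        have := Metric.mem_ball.1 ht
        exact Metric.mem_ball_self (dist_nonneg.trans_lt this)
      exact Set.uIoc_subset_uIcc.trans
        ((convex_ball s T).ordConnected.uIcc_subset hs ht)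
    calc ‖dysonTerm A b s x₀ (k + 1) t‖
        = ‖∫ τ in Set.uIoc s t, A τ (dysonTerm A b s x₀ k τ)‖ := by
          rw [dysonTerm, intervalIntegral.norm_intervalIntegral_eq]
      _ ≤ ∫ τ in Set.uIoc s t, K ^ (k + 1) * |τ - s| ^ k / k.factorial * C := by
          refine norm_integral_le_of_norm_le (Continuous.integrableOn_uIoc (by fun_prop)) ?_
          refine (ae_restrict_mem measurableSet_uIoc).mono fun τ hτ => ?_
          calc ‖A τ (dysonTerm A b s x₀ k τ)‖
              ≤ K * ((K * |τ - s|) ^ k / k.factorial * C) :=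
                (A τ).le_of_opNorm_le_of_le (hAK τ (hsub hτ)) (ih τ (hsub hτ))
            _ = _ := by rw [mul_pow]; ring
      _ ≤ _ := by
          apply le_of_abs_le
          rw [← intervalIntegral.abs_intervalIntegral_eq, intervalIntegral.integral_mul_const,
            intervalIntegral.integral_div, intervalIntegral.integral_const_mul, abs_mul, abs_div,
            abs_mul, intervalIntegral.abs_intervalIntegral_eq, integral_pow_abs_sub_uIoc, abs_div,
            abs_pow, abs_pow, abs_of_nonneg hK, abs_abs, mul_div, div_div, abs_of_nonneg hC,
            ← Nat.cast_succ, Nat.abs_cast, Nat.abs_cast, ← Nat.cast_mul, ← Nat.factorial_succ,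
            ← mul_pow]

/-- A linear differential equation with continuous coefficients has a global solution. -/
theorem exists_linearODE_solution [CompleteSpace E] (hA : Continuous A) (hb : Continuous b) (s : ℝ) (x₀ : E) :
    ∃ u : ℝ → E, (∀ t, HasDerivAt u (A t (u t) + b t) t) ∧ u s = x₀ := by
  have hs : ∀ k, dysonTerm A b s x₀ (k + 1) s = 0 := fun k => by simp [dysonTerm]
  have hbase : Summable fun k => dysonTerm A b s x₀ (k + 1) s := by simp [hs, summable_zero]
  refine ⟨fun t => dysonTerm A b s x₀ 0 t + ∑' k, dysonTerm A b s x₀ (k + 1) t, fun t => ?_, ?_⟩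
  -- The radius only has to put t inside an open ball around s; on its closure the coefficients are
  -- bounded, and the series may be differentiated termwise.
  · set T := |t - s| + 1 with hT
    have ht : t ∈ Metric.ball s T := by simp [Real.dist_eq, hT]
    obtain ⟨K, hK⟩ := (isCompact_closedBall s T).exists_bound_of_continuousOn hA.continuousOn
    obtain ⟨C, hC⟩ := (isCompact_closedBall s T).exists_bound_of_continuousOn
      (continuous_dysonTerm (x₀ := x₀) (s := s) hA hb 0).continuousOn
    have hsT : s ∈ Metric.closedBall s T := Metric.mem_closedBall_self (by positivity)
    have hK0 : 0 ≤ K := (norm_nonneg _).trans (hK s hsT)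
    have hC0 : 0 ≤ C := (norm_nonneg _).trans (hC s hsT)
    have hbd : ∀ k, ∀ y ∈ Metric.ball s T,
        ‖A y (dysonTerm A b s x₀ k y)‖ ≤ K * ((K * T) ^ k / k.factorial * C) := by
      intro k y hy
      refine (A y).le_of_opNorm_le_of_le (hK y (Metric.ball_subset_closedBall hy)) ?_
      refine (norm_dysonTerm_le hC0 hK0 (fun t ht => hK t (Metric.ball_subset_closedBall ht))
        (fun t ht => hC t (Metric.ball_subset_closedBall ht)) k y hy).trans ?_
      have : |y - s| ≤ T := by
        have := Metric.mem_ball.1 hy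
        rw [Real.dist_eq] at this
        exact this.le
      gcongr
    have hsum : Summable fun k : ℕ => K * ((K * T) ^ k / k.factorial * C) :=
      ((Real.summable_pow_div_factorial (K * T)).mul_right C).mul_left K
    have hd := hasDerivAt_tsum_of_isPreconnected hsum Metric.isOpen_ball
      (convex_ball s T).isPreconnected
      (fun k y _ => hasDerivAt_dysonTerm_succ (x₀ := x₀) (s := s) hA hb k y) hbd
      (Metric.mem_ball_self (by positivity)) hbase ht
    refine ((hasDerivAt_dysonTerm_zero hb t).add hd).congr_deriv ?_
    have hsk : Summable fun k => dysonTerm A b s x₀ k t := by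
      refine Summable.of_norm_bounded
        ((Real.summable_pow_div_factorial (K * |t - s|)).mul_right C) fun k => ?_
      exact norm_dysonTerm_le hC0 hK0 (fun t ht => hK t (Metric.ball_subset_closedBall ht))
        (fun t ht => hC t (Metric.ball_subset_closedBall ht)) k t ht
    -- Differentiation lowers the index by one, so the differentiated tail is A applied to the whole
    -- series; the zeroth term contributes b.
    rw [← (A t).map_tsum hsk, hsk.tsum_eq_zero_add, add_comm]
  · simp [dysonTerm]

theorem linearODE_solution_unique (hA : Continuous A) {u v : ℝ → E}
    (hu : ∀ t, HasDerivAt u (A t (u t) + b t) t) (hv : ∀ t, HasDerivAt v (A t (v t) + b t) t)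
    (h : u s = v s) : u = v := by
  funext t
  set T := |t - s| + 1 with hT
  obtain ⟨K, hK⟩ := (isCompact_closedBall s T).exists_bound_of_continuousOn hA.continuousOn
  have ht : t ∈ Set.Ioo (s - T) (s + T) := by
    rw [← Real.ball_eq_Ioo]; simp [Real.dist_eq, hT]
  have hs : s ∈ Set.Ioo (s - T) (s + T) := by
    rw [← Real.ball_eq_Ioo]; exact Metric.mem_ball_self (by positivity)
  refine ODE_solution_unique_of_mem_Ioo (v := fun t x => A t x + b t) (s := fun _ => Set.univ)
    (K := K.toNNReal) (fun τ hτ => ?_) hs (fun τ _ => ⟨hu τ, trivial⟩)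
    (fun τ _ => ⟨hv τ, trivial⟩) h ht
  refine LipschitzWith.lipschitzOnWith (LipschitzWith.of_dist_le_mul fun x y => ?_)
  rw [← Real.ball_eq_Ioo] at hτ
  have hKτ := hK τ (Metric.ball_subset_closedBall hτ)
  rw [dist_add_right, dist_eq_norm, dist_eq_norm, ← map_sub,
    Real.coe_toNNReal _ ((norm_nonneg _).trans hKτ)]
  exact (A τ).le_of_opNorm_le hKτ _

end LinearODE

/-! ### Matrix equations `A' = N A`, solved column by column. -/

section MatrixODE

variable {ι : Type*} [Fintype ι]

/-- `A' = N A`, entrywise. -/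
def IsMatrixSolution (N A : ℝ → Matrix ι ι ℝ) : Prop :=
  ∀ τ j k, HasDerivAt (fun σ => A σ j k) ((N τ * A τ) j k) τ

/-- The action of a matrix on vectors as a continuous linear map. -/
noncomputable def mulVecCLM (M : Matrix ι ι ℝ) : (ι → ℝ) →L[ℝ] (ι → ℝ) :=
  LinearMap.toContinuousLinearMap M.mulVecLin

@[simp] lemma mulVecCLM_apply (M : Matrix ι ι ℝ) (v : ι → ℝ) : mulVecCLM M v = M *ᵥ v := rfl

lemma continuous_mulVecCLM {N : ℝ → Matrix ι ι ℝ} (hN : Continuous N) :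
    Continuous fun t => mulVecCLM (N t) := by
  rw [continuous_clm_apply]
  intro v
  exact hN.matrix_mulVec continuous_const

lemma exists_isMatrixSolution [DecidableEq ι] {N : ℝ → Matrix ι ι ℝ} (hN : Continuous N) (s : ℝ) :
    ∃ A, IsMatrixSolution N A ∧ A s = 1 := by
  choose u hu hs using fun k : ι => exists_linearODE_solution (continuous_mulVecCLM hN)
    (b := fun _ => 0) continuous_const s (Pi.single k (1 : ℝ))
  refine ⟨fun τ => Matrix.of fun j k => u k τ j, fun τ j k => ?_, ?_⟩
  · have := hasDerivAt_pi.1 (hu k τ) j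
    simpa [Matrix.mul_apply, Matrix.mulVec, dotProduct] using this
  · ext j k
    simp [hs, Matrix.one_apply, Pi.single_apply]

lemma IsMatrixSolution.unique {N A B : ℝ → Matrix ι ι ℝ} {s : ℝ} (hN : Continuous N)
    (hA : IsMatrixSolution N A) (hB : IsMatrixSolution N B) (h : A s = B s) : A = B := by
  funext τ
  ext j k
  have := linearODE_solution_unique (continuous_mulVecCLM hN) (b := fun _ => 0) (s := s)
    (u := fun τ j => A τ j k) (v := fun τ j => B τ j k)
    (fun τ => hasDerivAt_pi.2 fun j => by
      simpa [Matrix.mul_apply, Matrix.mulVec, dotProduct] using hA τ j k)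
    (fun τ => hasDerivAt_pi.2 fun j => by
      simpa [Matrix.mul_apply, Matrix.mulVec, dotProduct] using hB τ j k)
    (by simp [h])
  exact congrFun (congrFun this τ) j

lemma hasDerivAt_matrix_mul {A B : ℝ → Matrix ι ι ℝ} {A' B' : Matrix ι ι ℝ} {τ : ℝ}
    (hA : ∀ j k, HasDerivAt (fun σ => A σ j k) (A' j k) τ)
    (hB : ∀ j k, HasDerivAt (fun σ => B σ j k) (B' j k) τ) (j k : ι) :
    HasDerivAt (fun σ => (A σ * B σ) j k) ((A' * B τ + A τ * B') j k) τ := by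
  simp only [Matrix.mul_apply, Matrix.add_apply, ← Finset.sum_add_distrib]
  exact HasDerivAt.fun_sum fun i _ => (hA j i).mul (hB i k)

lemma hasDerivAt_matrix_const {ι : Type*} {τ : ℝ} (C : Matrix ι ι ℝ) (j k : ι) :
    HasDerivAt (fun _ : ℝ => C j k) ((0 : Matrix ι ι ℝ) j k) τ :=
  hasDerivAt_const _ _

lemma IsMatrixSolution.mul_const {N A : ℝ → Matrix ι ι ℝ} (hA : IsMatrixSolution N A)
    (C : Matrix ι ι ℝ) : IsMatrixSolution N fun τ => A τ * C := fun τ j k => by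
  simpa [Matrix.mul_assoc] using
    hasDerivAt_matrix_mul (B' := 0) (hA τ) (fun j k => hasDerivAt_matrix_const C j k) j k

lemma IsMatrixSolution.continuous {N A : ℝ → Matrix ι ι ℝ} (hA : IsMatrixSolution N A) :
    Continuous A :=
  continuous_matrix fun j k => continuous_iff_continuousAt.2 fun τ => (hA τ j k).continuousAt

end MatrixODE

/-! ### The matricant: cocycle property, symplecticity, and its blocks. -/

section Trajectories

variable {n : ℕ} (D : Coeffs n) (κt : ℝ)

lemma continuous_hzz : Continuous (D.hzz κt) :=
  D.continuous_Hzz.add (D.continuous_Wzz.const_smul κt)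

lemma isSymm_hzz (t : ℝ) : (D.hzz κt t).IsSymm :=
  (D.isSymm_Hzz t).add ((D.isSymm_Wzz t).smul κt)

/-- The matrix `J 𝔥_zz` of the system in variations. -/
def variationMatrix (t : ℝ) : PhaseMat n := Matrix.J (Fin n) ℝ * D.hzz κt t

lemma continuous_variationMatrix : Continuous (variationMatrix D κt) :=
  continuous_const.matrix_mul (continuous_hzz D κt)

lemma matricant_spec (s : ℝ) :
    IsMatrixSolution (variationMatrix D κt) (fun τ => matricant D κt τ s) ∧
      matricant D κt s s = 1 :=
  Classical.epsilon_spec (exists_isMatrixSolution (continuous_variationMatrix D κt) s)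

lemma matricant_self (s : ℝ) : matricant D κt s s = 1 := (matricant_spec D κt s).2

/-- As functions of t both sides solve the system in variations, and they agree at t = r. -/
lemma matricant_mul (t r s : ℝ) :
    matricant D κt t r * matricant D κt r s = matricant D κt t s := by
  have h := ((matricant_spec D κt r).1.mul_const (matricant D κt r s)).unique (s := r)
    (continuous_variationMatrix D κt) (matricant_spec D κt s).1 (by simp [matricant_self])
  exact congrFun h t

lemma variationMatrix_transpose (t : ℝ) :
    (variationMatrix D κt t)ᵀ = -(D.hzz κt t * Matrix.J (Fin n) ℝ) := by
  rw [variationMatrix, Matrix.transpose_mul, (isSymm_hzz D κt t).eq, Matrix.J_transpose,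
    Matrix.mul_neg]

/-- The left side has derivative zero in t, because 𝔥_zz is symmetric and J² = -1, and it equals J
at t = s. -/
lemma transpose_matricant_mul_J_mul (t s : ℝ) :
    (matricant D κt t s)ᵀ * Matrix.J (Fin n) ℝ * matricant D κt t s = Matrix.J (Fin n) ℝ := by
  have hA := (matricant_spec D κt s).1
  ext j k
  have hd : ∀ τ, HasDerivAt (fun τ => ((matricant D κt τ s)ᵀ * Matrix.J (Fin n) ℝ *
      matricant D κt τ s) j k) 0 τ := by
    intro τ
    have h1 := hasDerivAt_matrix_mul (B' := 0)
      (A := fun τ => (matricant D κt τ s)ᵀ)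
      (A' := (variationMatrix D κt τ * matricant D κt τ s)ᵀ)
      (fun j k => by simpa using hA τ k j)
      (fun j k => hasDerivAt_matrix_const (Matrix.J (Fin n) ℝ) j k)
    refine (hasDerivAt_matrix_mul h1 (hA τ) j k).congr_deriv ?_
    have : (variationMatrix D κt τ * matricant D κt τ s)ᵀ * Matrix.J (Fin n) ℝ *
        matricant D κt τ s + (matricant D κt τ s)ᵀ * Matrix.J (Fin n) ℝ *
        (variationMatrix D κt τ * matricant D κt τ s) = 0 := by
      have hJ := Matrix.J_squared (l := Fin n) (R := ℝ)
      rw [Matrix.transpose_mul, variationMatrix_transpose, variationMatrix]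
      calc _ = (matricant D κt τ s)ᵀ * (-(D.hzz κt τ * (Matrix.J (Fin n) ℝ *
            Matrix.J (Fin n) ℝ)) + (Matrix.J (Fin n) ℝ * Matrix.J (Fin n) ℝ) * D.hzz κt τ) *
            matricant D κt τ s := by noncomm_ring
        _ = 0 := by rw [hJ]; simp
    simpa using congrFun (congrFun this j) k
  have hc := is_const_of_deriv_eq_zero (fun τ => (hd τ).differentiableAt) (fun τ => (hd τ).deriv)
    t s
  rw [hc, matricant_self]
  simp

lemma matricant_mem_symplecticGroup (t s : ℝ) :
    matricant D κt t s ∈ Matrix.symplecticGroup (Fin n) ℝ :=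
  SymplecticGroup.mem_iff'.2 (transpose_matricant_mul_J_mul D κt t s)

lemma matricant_eq_fromBlocks (t s : ℝ) : matricant D κt t s =
    fromBlocks (lam4 D κt t s)ᵀ (-(lam2 D κt t s)ᵀ) (-(lam3 D κt t s)ᵀ) (lam1 D κt t s)ᵀ := by
  simp [lam1, lam2, lam3, lam4, fromBlocks_toBlocks]

lemma matricant_inv (t s : ℝ) : matricant D κt s t =
    -(Matrix.J (Fin n) ℝ * (matricant D κt t s)ᵀ * Matrix.J (Fin n) ℝ) := by
  have h1 := SymplecticGroup.inv_left_mul_aux (matricant_mem_symplecticGroup D κt t s)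
  have h2 : matricant D κt t s * matricant D κt s t = 1 := by
    rw [matricant_mul, matricant_self]
  have h1' : -(Matrix.J (Fin n) ℝ * (matricant D κt t s)ᵀ * Matrix.J (Fin n) ℝ) *
      matricant D κt t s = 1 := by rw [Matrix.neg_mul]; exact h1
  exact (left_inv_eq_right_inv h1' h2).symm

/-- The inverse of a symplectic matrix is -J𝒜ᵀJ, which permutes and transposes the blocks. This
explains the transposes in the definition of the λ's: they are the plain blocks of 𝒜(s, t). -/
lemma matricant_swap (t s : ℝ) : matricant D κt s t =
    fromBlocks (lam1 D κt t s) (lam2 D κt t s) (lam3 D κt t s) (lam4 D κt t s) := by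
  rw [matricant_inv, matricant_eq_fromBlocks D κt t s, Matrix.J]
  simp [fromBlocks_transpose, fromBlocks_multiply, fromBlocks_neg]

lemma lam1_swap (t s : ℝ) : lam1 D κt s t = (lam4 D κt t s)ᵀ := by
  rw [lam1, matricant_swap D κt t s, toBlocks_fromBlocks₂₂]

lemma lam3_swap (t s : ℝ) : lam3 D κt s t = -(lam3 D κt t s)ᵀ := by
  rw [lam3, matricant_swap D κt t s, toBlocks_fromBlocks₂₁]

lemma lam4_swap (t s : ℝ) : lam4 D κt s t = (lam1 D κt t s)ᵀ := by
  rw [lam4, matricant_swap D κt t s, toBlocks_fromBlocks₁₁]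

/-- The symplectic relations between the blocks, read off from 𝒜(s, t)𝒜(t, s) = 1 and 𝒜(t, s)𝒜(s, t)
= 1. -/
lemma lam_mul (t s : ℝ) :
    lam4 D κt t s * (lam1 D κt t s)ᵀ - lam3 D κt t s * (lam2 D κt t s)ᵀ = 1 ∧
    lam4 D κt t s * (lam3 D κt t s)ᵀ = lam3 D κt t s * (lam4 D κt t s)ᵀ ∧
    (lam3 D κt t s)ᵀ * lam1 D κt t s = (lam1 D κt t s)ᵀ * lam3 D κt t s := by
  have h : matricant D κt s t * matricant D κt t s = 1 := by
    rw [matricant_mul, matricant_self]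
  have h' : matricant D κt t s * matricant D κt s t = 1 := by
    rw [matricant_mul, matricant_self]
  rw [matricant_swap D κt t s, matricant_eq_fromBlocks D κt t s, fromBlocks_multiply,
    ← fromBlocks_one, fromBlocks_inj] at h h'
  refine ⟨?_, ?_, ?_⟩
  · have := h.2.2.2
    rw [← this]; simp [sub_eq_add_neg, add_comm]
  · have := h.2.2.1
    simp only [Matrix.mul_neg] at this
    exact (add_neg_eq_zero.1 this).symm
  · have := h'.2.2.1
    simp only [Matrix.neg_mul] at this
    exact neg_add_eq_zero.1 this

/-- Factoring through time 0 separates the variables, and the inverse of 𝒜(s, 0) is polynomial in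
its entries by symplecticity. -/
lemma continuous_matricant : Continuous fun p : ℝ × ℝ => matricant D κt p.1 p.2 := by
  have h : ∀ p : ℝ × ℝ, matricant D κt p.1 p.2 = matricant D κt p.1 0 *
      -(Matrix.J (Fin n) ℝ * (matricant D κt p.2 0)ᵀ * Matrix.J (Fin n) ℝ) := fun p => by
    rw [← matricant_inv, matricant_mul]
  have hc : Continuous fun τ => matricant D κt τ 0 := (matricant_spec D κt 0).1.continuous
  simp_rw [h]
  exact (hc.comp continuous_fst).matrix_mul
    (((continuous_const.matrix_mul (hc.comp continuous_snd).matrix_transpose).matrix_mul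
      continuous_const).neg)

/-! ### Solutions of the Hamilton–Ehrenfest system -/

variable {D κt}

/-- The linear operator `Δ ↦ MΔ + Δ Mᵀ`, where `M = J 𝔥_zz`. -/
noncomputable def covarianceCLM (D : Coeffs n) (κt t : ℝ) :
    (Fin n ⊕ Fin n → Fin n ⊕ Fin n → ℝ) →L[ℝ] (Fin n ⊕ Fin n → Fin n ⊕ Fin n → ℝ) :=
  LinearMap.toContinuousLinearMap
    { toFun := fun Δ => Matrix.J (Fin n) ℝ * D.hzz κt t * Matrix.of Δ -
        Matrix.of Δ * D.hzz κt t * Matrix.J (Fin n) ℝ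
      map_add' := fun Δ Δ' => by
        change Matrix.J (Fin n) ℝ * D.hzz κt t * (Matrix.of Δ + Matrix.of Δ') -
          (Matrix.of Δ + Matrix.of Δ') * D.hzz κt t * Matrix.J (Fin n) ℝ = _ + _
        simp only [Matrix.mul_add, Matrix.add_mul]
        abel
      map_smul' := fun c Δ => by
        change Matrix.J (Fin n) ℝ * D.hzz κt t * (c • Matrix.of Δ) -
          (c • Matrix.of Δ) * D.hzz κt t * Matrix.J (Fin n) ℝ =
          c • (Matrix.J (Fin n) ℝ * D.hzz κt t * Matrix.of Δ -
            Matrix.of Δ * D.hzz κt t * Matrix.J (Fin n) ℝ)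
        rw [Matrix.mul_smul, Matrix.smul_mul, Matrix.smul_mul, smul_sub] }

lemma covarianceCLM_apply (t : ℝ) (Δ : PhaseMat n) (j k : Fin n ⊕ Fin n) :
    covarianceCLM D κt t Δ j k = (Matrix.J (Fin n) ℝ * D.hzz κt t * Δ -
      Δ * D.hzz κt t * Matrix.J (Fin n) ℝ) j k := rfl

lemma continuous_covarianceCLM : Continuous fun t => covarianceCLM D κt t := by
  rw [continuous_clm_apply]
  intro Δ
  have h := continuous_hzz D κt
  exact (((continuous_const.matrix_mul h).matrix_mul continuous_const).sub
    ((continuous_const.matrix_mul h).matrix_mul continuous_const) : Continuous fun t =>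
    Matrix.J (Fin n) ℝ * D.hzz κt t * Matrix.of Δ -
        Matrix.of Δ * D.hzz κt t * Matrix.J (Fin n) ℝ)

lemma continuous_meanMatrix : Continuous fun t =>
    Matrix.J (Fin n) ℝ * (D.Hzz t + κt • (D.Wzz t + D.Wzw t)) :=
  continuous_const.matrix_mul (D.continuous_Hzz.add
    ((D.continuous_Wzz.add D.continuous_Wzw).const_smul κt))

lemma IsHESSolution.hasDerivAt_fst {g : ℝ → PhaseVec n × PhaseMat n} (hg : IsHESSolution D κt g)
    (t : ℝ) : HasDerivAt (fun τ => (g τ).1)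
      (mulVecCLM (Matrix.J (Fin n) ℝ * (D.Hzz t + κt • (D.Wzz t + D.Wzw t))) (g t).1 +
        Matrix.J (Fin n) ℝ *ᵥ D.Hz t) t := by
  refine hasDerivAt_pi.2 fun k => (hg.1 t k).congr_deriv ?_
  rw [mulVecCLM_apply, ← Matrix.mulVec_mulVec, ← Matrix.mulVec_add, add_comm]

/-- With κt fixed the system splits into an affine equation for z and a linear equation for Δ. -/
lemma IsHESSolution.unique {g g' : ℝ → PhaseVec n × PhaseMat n} (hg : IsHESSolution D κt g)
    (hg' : IsHESSolution D κt g') {s : ℝ} (h : g s = g' s) : g = g' := by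
  have h1 := linearODE_solution_unique (s := s)
    (continuous_mulVecCLM (continuous_meanMatrix (D := D) (κt := κt)))
    hg.hasDerivAt_fst hg'.hasDerivAt_fst (by rw [h])
  have h2 := linearODE_solution_unique (b := fun _ => 0) (s := s)
    (continuous_covarianceCLM (D := D) (κt := κt))
    (u := fun τ => ((g τ).2 : Fin n ⊕ Fin n → Fin n ⊕ Fin n → ℝ))
    (v := fun τ => ((g' τ).2 : Fin n ⊕ Fin n → Fin n ⊕ Fin n → ℝ))
    (fun t => hasDerivAt_pi.2 fun j => hasDerivAt_pi.2 fun k => by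
      rw [add_zero, covarianceCLM_apply]; exact hg.2 t j k)
    (fun t => hasDerivAt_pi.2 fun j => hasDerivAt_pi.2 fun k => by
      rw [add_zero, covarianceCLM_apply]; exact hg'.2 t j k) (by rw [h])
  funext t
  exact Prod.ext (congrFun h1 t) (congrFun h2 t)

lemma hasDerivAt_covariance (Δ₀ : PhaseMat n) (s t : ℝ) (j k : Fin n ⊕ Fin n) :
    HasDerivAt (fun τ => (matricant D κt τ s * Δ₀ * (matricant D κt τ s)ᵀ) j k)
      ((Matrix.J (Fin n) ℝ * D.hzz κt t * (matricant D κt t s * Δ₀ * (matricant D κt t s)ᵀ) -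
        (matricant D κt t s * Δ₀ * (matricant D κt t s)ᵀ) * D.hzz κt t *
          Matrix.J (Fin n) ℝ) j k) t := by
  have hA := (matricant_spec D κt s).1
  refine (hasDerivAt_matrix_mul (hA.mul_const Δ₀ t) (B := fun τ => (matricant D κt τ s)ᵀ)
    (B' := (variationMatrix D κt t * matricant D κt t s)ᵀ)
    (fun j k => by simpa using hA t k j) j k).congr_deriv ?_
  rw [Matrix.transpose_mul, variationMatrix_transpose, variationMatrix]
  noncomm_ring

lemma exists_isHESSolution (s : ℝ) (g₀ : PhaseVec n × PhaseMat n) :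
    ∃ g, IsHESSolution D κt g ∧ g s = g₀ := by
  obtain ⟨z, hz, hzs⟩ := exists_linearODE_solution
    (continuous_mulVecCLM (continuous_meanMatrix (D := D) (κt := κt)))
    (b := fun t => Matrix.J (Fin n) ℝ *ᵥ D.Hz t)
    (continuous_const.matrix_mulVec D.continuous_Hz) s g₀.1
  refine ⟨fun t => (z t, matricant D κt t s * g₀.2 * (matricant D κt t s)ᵀ),
    ⟨fun t k => ?_, fun t j k => hasDerivAt_covariance g₀.2 s t j k⟩, ?_⟩
  · refine (hasDerivAt_pi.1 (hz t) k).congr_deriv ?_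
    rw [mulVecCLM_apply, ← Matrix.mulVec_mulVec, ← Matrix.mulVec_add, add_comm]
  · simp [hzs, matricant_self]

lemma hesSolution_spec (s : ℝ) (g₀ : PhaseVec n × PhaseMat n) :
    IsHESSolution D κt (hesSolution D κt s g₀) ∧ hesSolution D κt s g₀ s = g₀ :=
  Classical.epsilon_spec (exists_isHESSolution s g₀)

/-- A trajectory may be restarted from its value at any time. This is what lets the backward
operator recover the forward trajectory. -/
lemma hesSolution_eq_of_isHESSolution {g : ℝ → PhaseVec n × PhaseMat n}
    (hg : IsHESSolution D κt g) (t : ℝ) : hesSolution D κt t (g t) = g :=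
  (hesSolution_spec t (g t)).1.unique hg (hesSolution_spec t (g t)).2

lemma hesSolution_snd (s t : ℝ) (g₀ : PhaseVec n × PhaseMat n) :
    (hesSolution D κt s g₀ t).2 = matricant D κt t s * g₀.2 * (matricant D κt t s)ᵀ := by
  obtain ⟨hg, hs⟩ := hesSolution_spec (D := D) (κt := κt) s g₀
  have h : IsHESSolution D κt fun t => ((hesSolution D κt s g₀ t).1,
      matricant D κt t s * g₀.2 * (matricant D κt t s)ᵀ) :=
    ⟨hg.1, fun t j k => hasDerivAt_covariance g₀.2 s t j k⟩
  have := hg.unique h (s := s) (by simp [hs, matricant_self])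
  exact congrArg Prod.snd (congrFun this t)

end Trajectories

/-! ### Continuation of square roots -/

section SqrtAlong

lemma sqrtAlong_self (f : ℝ → ℂ) (s : ℝ) : sqrtAlong f s s = f s ^ (1 / 2 : ℂ) := by
  simp [sqrtAlong]

lemma cpow_half_sq (z : ℂ) : (z ^ (1 / 2 : ℂ)) ^ 2 = z := by
  rw [← Complex.cpow_nat_mul]; norm_num

/-- The function f · exp(-∫ f'/f) has derivative zero, so it keeps its value f(s). -/
lemma sqrtAlong_sq {f f' : ℝ → ℂ} (hf : ∀ τ, HasDerivAt f (f' τ) τ) (hf' : Continuous f')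
    (h0 : ∀ τ, f τ ≠ 0) (s t : ℝ) : sqrtAlong f s t ^ 2 = f t := by
  have hc : Continuous f := continuous_iff_continuousAt.2 fun τ => (hf τ).continuousAt
  have hl : Continuous (logDeriv f) := by
    have : logDeriv f = fun τ => f' τ / f τ := by
      funext τ; rw [logDeriv_apply, (hf τ).deriv]
    rw [this]
    exact hf'.div hc h0
  set I : ℝ → ℂ := fun t => ∫ τ in s..t, logDeriv f τ
  have hI : ∀ t, HasDerivAt I (logDeriv f t) t := fun t =>
    (hl.integral_hasStrictDerivAt s t).hasDerivAt
  have hd : ∀ t, HasDerivAt (fun t => f t * Complex.exp (-I t)) 0 t := by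
    intro t
    refine ((hf t).mul (hI t).neg.cexp).congr_deriv ?_
    rw [logDeriv_apply, (hf t).deriv]
    field_simp [h0 t]
    ring
  have hconst := is_const_of_deriv_eq_zero (fun τ => (hd τ).differentiableAt)
    (fun τ => (hd τ).deriv) t s
  have hIs : I s = 0 := by simp [I]
  rw [hIs] at hconst
  simp only [neg_zero, Complex.exp_zero, mul_one] at hconst
  rw [sqrtAlong, mul_pow, cpow_half_sq, ← hconst, ← Complex.exp_nat_mul, mul_assoc,
    ← Complex.exp_add]
  have : -I t + (2 : ℕ) * (1 / 2 * ∫ τ in s..t, logDeriv f τ) = 0 := by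
    push_cast; simp only [I]; ring
  rw [this, Complex.exp_zero, mul_one]

/-- Continuity of the continued root in a parameter and in both endpoints of the path. -/
lemma continuous_sqrtAlong {X : Type*} [TopologicalSpace X] [FirstCountableTopology X]
    {F F' : X → ℝ → ℂ} {a b : X → ℝ}
    (hF : ∀ x τ, HasDerivAt (F x) (F' x τ) τ) (hFc : Continuous fun p : X × ℝ => F p.1 p.2)
    (hF'c : Continuous fun p : X × ℝ => F' p.1 p.2) (h0 : ∀ x τ, F x τ ≠ 0)
    (ha : Continuous a) (hb : Continuous b) (hpos : ∀ x, F x (a x) ∈ Complex.slitPlane) :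
    Continuous fun x => sqrtAlong (F x) (a x) (b x) := by
  have hl : Continuous fun p : X × ℝ => logDeriv (F p.1) p.2 := by
    simp_rw [logDeriv_apply, (hF _ _).deriv]
    exact hF'c.div hFc fun p => h0 _ _
  have hi : ∀ x τ₁ τ₂, IntervalIntegrable (logDeriv (F x)) volume τ₁ τ₂ := fun x τ₁ τ₂ =>
    (hl.comp (Continuous.prodMk continuous_const continuous_id)).intervalIntegrable _ _
  have hI : ∀ c : X → ℝ, Continuous c →
      Continuous fun x => ∫ τ in (0 : ℝ)..c x, logDeriv (F x) τ := fun c hc =>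
    intervalIntegral.continuous_parametric_intervalIntegral_of_continuous hl hc
  -- Splitting at 0 leaves integrals with one moving endpoint each.
  have hab : ∀ x, ∫ τ in a x..b x, logDeriv (F x) τ =
      (∫ τ in (0 : ℝ)..b x, logDeriv (F x) τ) - ∫ τ in (0 : ℝ)..a x, logDeriv (F x) τ := fun x =>
    (intervalIntegral.integral_interval_sub_left (hi _ _ _) (hi _ _ _)).symm
  simp only [sqrtAlong, hab]
  refine Continuous.mul ?_ (Complex.continuous_exp.comp
    (continuous_const.mul ((hI b hb).sub (hI a ha))))
  exact (hFc.comp (continuous_id.prodMk ha)).cpow continuous_const hpos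

/-- Continuing in the first or in the second variable of a Hermitian function gives conjugate
roots. -/
lemma sqrtAlong_swap {F F' : ℝ → ℝ → ℂ} (hF : ∀ u τ, HasDerivAt (fun τ => F τ u) (F' τ u) τ)
    (hFc : Continuous fun p : ℝ × ℝ => F p.1 p.2) (hF'c : Continuous fun p : ℝ × ℝ => F' p.1 p.2)
    (h0 : ∀ τ u, F τ u ≠ 0) {c : ℝ} (hc : 0 < c) (hdiag : ∀ u, F u u = c)
    (hswap : ∀ τ u, F u τ = star (F τ u)) (t s : ℝ) :
    sqrtAlong (fun τ => F τ t) t s = star (sqrtAlong (fun τ => F τ s) s t) := by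
  have hslit : ∀ u, F u u ∈ Complex.slitPlane := fun u => by
    rw [hdiag]; exact Complex.ofReal_mem_slitPlane.2 hc
  have hFc' : Continuous fun p : ℝ × ℝ => F p.2 p.1 := hFc.comp continuous_swap
  have hF'c' : Continuous fun p : ℝ × ℝ => F' p.2 p.1 := hF'c.comp continuous_swap
  have hv : Continuous fun u => star (sqrtAlong (fun τ => F τ u) u t) :=
    continuous_star.comp (continuous_sqrtAlong (F := fun u τ => F τ u) (F' := fun u τ => F' τ u)
      hF hFc' hF'c' (fun u τ => h0 τ u) continuous_id continuous_const hslit)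
  have hw : Continuous fun u => sqrtAlong (fun τ => F τ t) t u :=
    continuous_sqrtAlong (F := fun _ τ => F τ t) (F' := fun _ τ => F' τ t) (fun _ => hF t)
      (hFc.comp (continuous_snd.prodMk continuous_const))
      (hF'c.comp (continuous_snd.prodMk continuous_const)) (fun _ τ => h0 τ t)
      continuous_const continuous_id fun _ => hslit t
  have hcont : ∀ u, Continuous fun τ => F' τ u := fun u =>
    hF'c.comp (continuous_id.prodMk continuous_const)
  have hv2 : ∀ u, star (sqrtAlong (fun τ => F τ u) u t) ^ 2 = F u t := fun u => by
    rw [← star_pow, sqrtAlong_sq (hF u) (hcont u) (fun τ => h0 τ u), ← hswap]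
  -- Both sides are regarded as functions of u in place of s. On the left the end of the path moves,
  -- on the right its base point. Both are continuous roots of the nonvanishing function u ↦ F u t,
  -- and at u = t both equal the positive root of c.
  refine isPreconnected_univ.eq_of_sq_eq hw.continuousOn hv.continuousOn (fun u _ => ?_)
    (fun {u} _ h => ?_) (Set.mem_univ t) ?_ (Set.mem_univ s)
  · simp only [Pi.pow_apply]
    rw [sqrtAlong_sq (hF t) (hcont t) (fun τ => h0 τ t), hv2]
  · have := hv2 u
    rw [h] at this
    exact h0 u t (by rw [← this]; simp)
  · simp only [sqrtAlong_self, hdiag]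
    have : ((c : ℂ) ^ (1 / 2 : ℂ)) = ((c ^ (1 / 2 : ℝ) : ℝ) : ℂ) := by
      rw [Complex.ofReal_cpow hc.le]; norm_num
    rw [this]; simp

/-- A continuous root of a function with a nonzero limit has a limit. -/
lemma exists_tendsto_of_sq_tendsto {R f : ℝ → ℂ} (hR : ContinuousOn R (Set.Ioi 0))
    (hf : Continuous f) (hsq : ∀ ε > 0, R ε ^ 2 = f ε) (h0 : f 0 ≠ 0) :
    ∃ r, r ^ 2 = f 0 ∧ Tendsto R (𝓝[>] 0) (𝓝 r) := by
  have hq : Continuous fun ε => f ε / f 0 := hf.div_const _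
  have hnear : ∀ᶠ ε in 𝓝 (0 : ℝ), f ε / f 0 ∈ Complex.slitPlane :=
    hq.continuousAt.eventually (Complex.isOpen_slitPlane.mem_nhds (by simp [h0]))
  obtain ⟨δ, hδ, hball⟩ := Metric.eventually_nhds_iff_ball.1 hnear
  have hslit : ∀ ε ∈ Set.Ioo 0 δ, f ε / f 0 ∈ Complex.slitPlane := fun ε hε =>
    hball ε (by simp [abs_lt]; constructor <;> linarith [hε.1, hε.2])
  -- A comparison root that is continuous up to 0: the quotient f ε / f 0 stays near 1, hence off
  -- the cut of the principal root. On the connected interval (0, δ) the given root is this one or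
  -- its negative.
  set r := (f 0) ^ (1 / 2 : ℂ)
  set b : ℝ → ℂ := fun ε => r * (f ε / f 0) ^ (1 / 2 : ℂ)
  have hb2 : ∀ ε, b ε ^ 2 = f ε := fun ε => by
    simp only [b, mul_pow, r, cpow_half_sq]; field_simp
  have hbc : ContinuousOn b (Set.Ioo 0 δ) :=
    continuousOn_const.mul (hq.continuousOn.cpow continuousOn_const hslit)
  have hb0 : Tendsto b (𝓝[>] 0) (𝓝 r) := by
    have : ContinuousAt b 0 := continuousAt_const.mul
      (hq.continuousAt.cpow continuousAt_const (by simp [h0]))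
    have hb00 : b 0 = r := by simp [b, h0]
    rw [← hb00]
    exact this.tendsto.mono_left nhdsWithin_le_nhds
  have hmem : Set.Ioo 0 δ ∈ 𝓝[>] (0 : ℝ) := Ioo_mem_nhdsGT hδ
  have hne : ∀ ε ∈ Set.Ioo 0 δ, b ε ≠ 0 := fun ε hε h => by
    have h1 := Complex.slitPlane_ne_zero (hslit ε hε)
    have h2 := hb2 ε
    rw [h] at h2
    apply h1; rw [← h2]; simp
  rcases isPreconnected_Ioo.eq_or_eq_neg_of_sq_eq (hR.mono Set.Ioo_subset_Ioi_self) hbc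
    (fun ε hε => by simp only [Pi.pow_apply]; rw [hsq ε hε.1, hb2]) (fun {ε} hε => hne ε hε)
    with h | h
  · exact ⟨r, cpow_half_sq _, hb0.congr' (by filter_upwards [hmem] with ε hε using (h hε).symm)⟩
  · refine ⟨-r, by rw [neg_sq, cpow_half_sq], hb0.neg.congr' ?_⟩
    filter_upwards [hmem] with ε hε using (h hε).symm

end SqrtAlong

/-! ### Derivative of a determinant -/

section DetDeriv

variable {ι : Type*} [Fintype ι] [DecidableEq ι]

/-- The derivative of the determinant at `M` in the direction `M'`. -/
noncomputable def detDeriv (M M' : Matrix ι ι ℂ) : ℂ :=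
  ∑ σ : Equiv.Perm ι, ((Equiv.Perm.sign σ : ℤ) : ℂ) *
    ∑ i, (∏ j ∈ Finset.univ.erase i, M (σ j) j) * M' (σ i) i

lemma hasDerivAt_det {M : ℝ → Matrix ι ι ℂ} {M' : Matrix ι ι ℂ} {τ : ℝ}
    (h : ∀ i j, HasDerivAt (fun τ => M τ i j) (M' i j) τ) :
    HasDerivAt (fun τ => (M τ).det) (detDeriv (M τ) M') τ := by
  simp only [Matrix.det_apply', detDeriv]
  refine HasDerivAt.fun_sum fun σ _ => HasDerivAt.const_mul _ ?_
  exact HasDerivAt.fun_finsetProd fun i _ => h (σ i) i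

lemma continuous_detDeriv {X : Type*} [TopologicalSpace X] {M M' : X → Matrix ι ι ℂ}
    (hM : Continuous M) (hM' : Continuous M') : Continuous fun x => detDeriv (M x) (M' x) := by
  unfold detDeriv
  refine continuous_finsetSum _ fun σ _ => continuous_const.mul
    (continuous_finsetSum _ fun i _ => Continuous.mul
      (continuous_finsetProd _ fun j _ => hM.matrix_elem _ _) (hM'.matrix_elem _ _))

end DetDeriv

/-! ### The regularized determinant -/

section RegularizedDeterminant

variable {n : ℕ}

/-- The matrix of the regularized determinant as a function of the matricant. -/
noncomputable def regMatrix (ħ ε : ℝ) (A : PhaseMat n) : Matrix (Fin n) (Fin n) ℂ :=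
  (-Complex.I * 2 * Real.pi * ħ) •
    ((-A.toBlocks₂₁ᵀ).map Complex.ofReal +
      (Complex.I * ε) • (A.toBlocks₂₂ᵀ + A.toBlocks₁₁ᵀ).map Complex.ofReal -
      ((ε : ℂ) ^ 2) • (-A.toBlocks₁₂ᵀ).map Complex.ofReal)

lemma regMatrix_apply (ħ ε : ℝ) (A : PhaseMat n) (i j : Fin n) : regMatrix ħ ε A i j =
    (-Complex.I * 2 * Real.pi * ħ) * (-(A (Sum.inr j) (Sum.inl i) : ℂ) +
      Complex.I * ε * (A (Sum.inr j) (Sum.inr i) + A (Sum.inl j) (Sum.inl i)) +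
      (ε : ℂ) ^ 2 * A (Sum.inl j) (Sum.inr i)) := by
  simp [regMatrix, Matrix.toBlocks₁₁, Matrix.toBlocks₁₂, Matrix.toBlocks₂₁, Matrix.toBlocks₂₂]

lemma regDet_eq (D : Coeffs n) (ħ κt ε t s : ℝ) :
    regDet D ħ κt ε t s = (regMatrix ħ ε (matricant D κt t s)).det := rfl

lemma continuous_regMatrix {X : Type*} [TopologicalSpace X] (ħ : ℝ) {ε : X → ℝ}
    {A : X → PhaseMat n} (hε : Continuous ε) (hA : Continuous A) :
    Continuous fun x => regMatrix ħ (ε x) (A x) := by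
  refine continuous_matrix fun i j => ?_
  simp only [regMatrix_apply]
  have h : ∀ a b, Continuous fun x => (A x a b : ℂ) := fun a b =>
    Complex.continuous_ofReal.comp (hA.matrix_elem a b)
  have := Complex.continuous_ofReal.comp hε
  fun_prop

/-- The time derivative of the regularized determinant. -/
noncomputable def regDetDeriv (D : Coeffs n) (ħ κt ε t s : ℝ) : ℂ :=
  detDeriv (regMatrix ħ ε (matricant D κt t s))
    (regMatrix ħ ε (variationMatrix D κt t * matricant D κt t s))

lemma hasDerivAt_regDet (D : Coeffs n) (ħ κt ε s τ : ℝ) :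
    HasDerivAt (fun τ => regDet D ħ κt ε τ s) (regDetDeriv D ħ κt ε τ s) τ := by
  simp only [regDet_eq]
  refine hasDerivAt_det fun i j => ?_
  have h := fun j k => ((matricant_spec D κt s).1 τ j k).ofReal_comp
  simp only [regMatrix_apply]
  exact (((h _ _).neg.add (((h _ _).add (h _ _)).const_mul _)).add
    ((h _ _).const_mul _)).const_mul _

section

variable {X : Type*} [TopologicalSpace X] (D : Coeffs n) (ħ κt : ℝ) {ε τ s : X → ℝ}

lemma continuous_matricant_comp (hτ : Continuous τ) (hs : Continuous s) :
    Continuous fun x => matricant D κt (τ x) (s x) :=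
  Continuous.comp (g := fun p : ℝ × ℝ => matricant D κt p.1 p.2) (continuous_matricant D κt)
    (hτ.prodMk hs)

lemma continuous_regDet (hε : Continuous ε) (hτ : Continuous τ) (hs : Continuous s) :
    Continuous fun x => regDet D ħ κt (ε x) (τ x) (s x) := by
  simp only [regDet_eq]
  exact (continuous_regMatrix ħ hε (continuous_matricant_comp D κt hτ hs)).matrix_det

lemma continuous_regDetDeriv (hε : Continuous ε) (hτ : Continuous τ) (hs : Continuous s) :
    Continuous fun x => regDetDeriv D ħ κt (ε x) (τ x) (s x) := by
  have h := continuous_matricant_comp D κt hτ hs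
  simp only [regDetDeriv]
  exact continuous_detDeriv (continuous_regMatrix ħ hε h)
    (continuous_regMatrix ħ hε (((continuous_variationMatrix D κt).comp hτ).matrix_mul h))

end

/-- At t = s the off-diagonal blocks vanish and λ₁ = λ₄ = 1, so the matrix is -i2πħ · 2iε = 4πħε
times the identity. -/
lemma regDet_self (D : Coeffs n) (ħ κt ε s : ℝ) :
    regDet D ħ κt ε s s = ((4 * Real.pi * ħ * ε) ^ n : ℝ) := by
  have : regMatrix ħ ε (1 : PhaseMat n) = ((4 * Real.pi * ħ * ε : ℝ) : ℂ) • 1 := by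
    ext i j
    rw [regMatrix_apply]
    by_cases h : i = j
    · subst h
      simp
      linear_combination (-4 * (Real.pi : ℂ) * ħ * ε) * Complex.I_sq
    · simp [h, Ne.symm h]
  rw [regDet_eq, matricant_self, this, Matrix.det_smul]
  simp

/-- Exchanging the times transposes and interchanges λ₁ and λ₄, and turns λ₂, λ₃ into their negative
transposes. With the factors -i and iε this is exactly the conjugate transpose. -/
lemma regDet_swap (D : Coeffs n) (ħ κt ε t s : ℝ) :
    regDet D ħ κt ε s t = star (regDet D ħ κt ε t s) := by
  have : regMatrix ħ ε (matricant D κt s t) = (regMatrix ħ ε (matricant D κt t s))ᴴ := by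
    ext i j
    rw [Matrix.conjTranspose_apply, regMatrix_apply, regMatrix_apply, matricant_swap D κt t s]
    simp [lam1, lam2, lam3, lam4, Matrix.toBlocks₁₁, Matrix.toBlocks₁₂, Matrix.toBlocks₂₁,
      Matrix.toBlocks₂₂]
    ring
  rw [regDet_eq, regDet_eq, this, Matrix.det_conjTranspose]

/-- The symplectic Hermitian form on vectors of the shape `(v, i r v)`. -/
lemma star_dotProduct_J_mulVec {r : ℝ} {y : Fin n ⊕ Fin n → ℂ}
    (h : ∀ i, y (Sum.inr i) = Complex.I * r * y (Sum.inl i)) :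
    star y ⬝ᵥ (Matrix.J (Fin n) ℂ *ᵥ y) =
      -2 * Complex.I * ((r * ∑ i, Complex.normSq (y (Sum.inl i)) : ℝ) : ℂ) := by
  have h1 : ∀ i, (Matrix.J (Fin n) ℂ *ᵥ y) (Sum.inl i) = -y (Sum.inr i) := fun i => by
    rw [Matrix.J, fromBlocks_mulVec]; simp [Matrix.neg_mulVec]
  have h2 : ∀ i, (Matrix.J (Fin n) ℂ *ᵥ y) (Sum.inr i) = y (Sum.inl i) := fun i => by
    rw [Matrix.J, fromBlocks_mulVec]; simp
  simp only [dotProduct, Fintype.sum_sum_type, h1, h2, Pi.star_apply, h]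
  push_cast
  rw [← Finset.sum_add_distrib, Finset.mul_sum, Finset.mul_sum]
  refine Finset.sum_congr rfl fun i _ => ?_
  rw [Complex.normSq_eq_conj_mul_self]
  simp
  ring

/-- A null vector v of the transposed matrix means that 𝒜 maps (v, -iεv) to a vector of the form
(v', iεv'). The form u ↦ ⟨u, Ju⟩ is preserved by the real symplectic 𝒜 but has opposite signs on
vectors of these two shapes, so it vanishes on both, and v = 0. -/
lemma regDet_ne_zero (D : Coeffs n) {ħ ε : ℝ} (hħ : 0 < ħ) (hε : 0 < ε) (κt t s : ℝ) :
    regDet D ħ κt ε t s ≠ 0 := by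
  intro hdet
  rw [regDet_eq, ← Matrix.det_transpose] at hdet
  obtain ⟨v, hv0, hv⟩ := Matrix.exists_mulVec_eq_zero_iff.2 hdet
  set A := matricant D κt t s with hA
  set Ac : Matrix (Fin n ⊕ Fin n) (Fin n ⊕ Fin n) ℂ := A.map Complex.ofReal with hAc
  set w : Fin n ⊕ Fin n → ℂ :=
    Sum.elim v (fun i => Complex.I * (-ε : ℝ) * v i) with hw
  set u := Ac *ᵥ w with hu
  have hc : (-Complex.I * 2 * Real.pi * ħ) ≠ 0 := by
    simp [Real.pi_ne_zero, hħ.ne']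
  have hu' : ∀ i, u (Sum.inr i) = Complex.I * ε * u (Sum.inl i) := fun i => by
    have h := congrFun hv i
    simp only [Matrix.mulVec, dotProduct, Matrix.transpose_apply, regMatrix_apply, Pi.zero_apply,
      mul_assoc, ← Finset.mul_sum] at h
    have h' : ∑ j, (-(A (Sum.inr i) (Sum.inl j) : ℂ) +
      Complex.I * (ε * (A (Sum.inr i) (Sum.inr j) + A (Sum.inl i) (Sum.inl j))) +
      (ε : ℂ) ^ 2 * A (Sum.inl i) (Sum.inr j)) * v j = 0 := by
      have hc' : -Complex.I * (2 * (Real.pi * (ħ : ℂ))) ≠ 0 := by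
        simpa [mul_assoc] using hc
      refine (mul_eq_zero.1 ?_).resolve_left hc'
      rw [← h]
      simp only [mul_assoc]
    rw [← sub_eq_zero, ← neg_eq_zero, ← h']
    simp only [hu, hw, hAc, Matrix.mulVec, dotProduct, Fintype.sum_sum_type, Sum.elim_inl,
      Sum.elim_inr, Matrix.map_apply]
    rw [← Finset.sum_add_distrib, ← Finset.sum_add_distrib, Finset.mul_sum,
      ← Finset.sum_sub_distrib, ← Finset.sum_neg_distrib]
    refine Finset.sum_congr rfl fun j _ => ?_
    push_cast
    linear_combination (-(ε : ℂ) ^ 2 * A (Sum.inl i) (Sum.inr j) * v j) * Complex.I_sq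
  have hJ : Acᵀ * Matrix.J (Fin n) ℂ * Ac = Matrix.J (Fin n) ℂ := by
    have h := congrArg (fun M : PhaseMat n => M.map (Complex.ofRealHom))
      (transpose_matricant_mul_J_mul D κt t s)
    simp only [Matrix.map_mul, Matrix.map_J] at h
    exact h
  have hstar : star u = Ac *ᵥ star w := by
    ext i
    simp [hu, hAc, Matrix.mulVec, dotProduct]
  have hform : star u ⬝ᵥ (Matrix.J (Fin n) ℂ *ᵥ u) = star w ⬝ᵥ (Matrix.J (Fin n) ℂ *ᵥ w) := by
    conv_rhs => rw [← hJ]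
    rw [hstar, hu, ← Matrix.mulVec_mulVec, ← Matrix.mulVec_mulVec,
      Matrix.dotProduct_mulVec (star w) Acᵀ, Matrix.vecMul_transpose]
  rw [star_dotProduct_J_mulVec hu', star_dotProduct_J_mulVec (r := -ε) fun i => by simp [hw]]
    at hform
  have h2 := mul_left_cancel₀ (by simp) hform
  -- Invariance of the form now reads ε∑|u|² = -ε∑|w|² over the momentum components.
  rw [Complex.ofReal_inj] at h2
  have h3 : 0 ≤ ∑ i, Complex.normSq (u (Sum.inl i)) :=
    Finset.sum_nonneg fun i _ => Complex.normSq_nonneg _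
  have h4 : ∑ i, Complex.normSq (w (Sum.inl i)) = 0 := by
    refine le_antisymm ?_ (Finset.sum_nonneg fun i _ => Complex.normSq_nonneg _)
    nlinarith
  rw [Finset.sum_eq_zero_iff_of_nonneg fun i _ => Complex.normSq_nonneg _] at h4
  exact hv0 (funext fun i => Complex.normSq_eq_zero.1 (h4 i (Finset.mem_univ i)))

/-! ### The branch of the root in the Green function -/

lemma regDet_zero (D : Coeffs n) (ħ κt t s : ℝ) :
    regDet D ħ κt 0 t s = (-Complex.I * 2 * Real.pi * ħ) ^ n * (lam3 D κt t s).det := by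
  simp only [regDet, Complex.ofReal_zero, mul_zero, zero_smul, add_zero, ne_eq,
    OfNat.ofNat_ne_zero, not_false_eq_true, zero_pow, sub_zero, Matrix.det_smul,
    Fintype.card_fin]
  congr 1
  exact (Complex.ofRealHom.map_det _).symm

lemma continuousOn_sqrtAlong_regDet (D : Coeffs n) {ħ : ℝ} (hħ : 0 < ħ) (κt t s : ℝ) :
    ContinuousOn (fun ε => sqrtAlong (fun τ => regDet D ħ κt ε τ s) s t) (Set.Ioi 0) := by
  have h1 : Continuous fun p : Set.Ioi (0 : ℝ) × ℝ => regDet D ħ κt p.1 p.2 s :=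
    continuous_regDet D ħ κt (continuous_subtype_val.comp continuous_fst) continuous_snd
      continuous_const
  have h2 : Continuous fun p : Set.Ioi (0 : ℝ) × ℝ => regDetDeriv D ħ κt p.1 p.2 s :=
    continuous_regDetDeriv D ħ κt (continuous_subtype_val.comp continuous_fst) continuous_snd
      continuous_const
  have h3 : ∀ ε : Set.Ioi (0 : ℝ), regDet D ħ κt ε s s ∈ Complex.slitPlane := fun ε => by
    have hε : (0 : ℝ) < ε := ε.2
    rw [regDet_self]
    exact Complex.ofReal_mem_slitPlane.2 (by positivity)
  rw [continuousOn_iff_continuous_domRestrict]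
  exact continuous_sqrtAlong (X := Set.Ioi (0 : ℝ)) (a := fun _ => s) (b := fun _ => t)
      (F := fun ε τ => regDet D ħ κt ε τ s) (F' := fun ε τ => regDetDeriv D ħ κt ε τ s)
      (fun ε τ => hasDerivAt_regDet D ħ κt ε s τ) h1 h2
      (fun ε τ => regDet_ne_zero D hħ ε.2 κt τ s) continuous_const continuous_const h3

/-- Only the final determinant, at time t, has to stay away from zero as ε → 0; zeros of det λ₃ at
intermediate times do no harm. The limit in `sqrtDet` therefore exists. -/
lemma exists_tendsto_sqrtAlong_regDet (D : Coeffs n) {ħ : ℝ} (hħ : 0 < ħ) (κt t s : ℝ)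
    (hdet : (lam3 D κt t s).det ≠ 0) :
    ∃ r, r ^ 2 = regDet D ħ κt 0 t s ∧
      Tendsto (fun ε => sqrtAlong (fun τ => regDet D ħ κt ε τ s) s t) (𝓝[>] 0) (𝓝 r) := by
  refine exists_tendsto_of_sq_tendsto (f := fun ε => regDet D ħ κt ε t s)
    (continuousOn_sqrtAlong_regDet D hħ κt t s)
    (continuous_regDet D ħ κt continuous_id continuous_const continuous_const)
    (fun ε hε => ?_) ?_
  · have h := continuous_regDetDeriv D ħ κt (ε := fun _ : ℝ => ε) (s := fun _ : ℝ => s)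
      continuous_const continuous_id continuous_const
    exact sqrtAlong_sq (f := fun τ => regDet D ħ κt ε τ s)
      (fun τ => hasDerivAt_regDet D ħ κt ε s τ) h
      (fun τ => regDet_ne_zero D hħ hε κt τ s) s t
  · rw [regDet_zero]
    exact mul_ne_zero (pow_ne_zero _ (by simp [Real.pi_ne_zero, hħ.ne']))
      (Complex.ofReal_ne_zero.2 hdet)

lemma sqrtDet_sq (D : Coeffs n) {ħ : ℝ} (hħ : 0 < ħ) (κt t s : ℝ)
    (hdet : (lam3 D κt t s).det ≠ 0) :
    sqrtDet D ħ κt t s ^ 2 = (-Complex.I * 2 * Real.pi * ħ) ^ n * (lam3 D κt t s).det := by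
  obtain ⟨r, hr, hlim⟩ := exists_tendsto_sqrtAlong_regDet D hħ κt t s hdet
  rw [sqrtDet, hlim.limUnder_eq, hr, regDet_zero]

lemma sqrtAlong_regDet_swap (D : Coeffs n) {ħ ε : ℝ} (hħ : 0 < ħ) (hε : 0 < ε) (κt t s : ℝ) :
    sqrtAlong (fun τ => regDet D ħ κt ε τ t) t s =
      star (sqrtAlong (fun τ => regDet D ħ κt ε τ s) s t) := by
  have h1 : Continuous fun p : ℝ × ℝ => regDet D ħ κt ε p.1 p.2 :=
    continuous_regDet D ħ κt continuous_const continuous_fst continuous_snd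
  have h2 : Continuous fun p : ℝ × ℝ => regDetDeriv D ħ κt ε p.1 p.2 :=
    continuous_regDetDeriv D ħ κt continuous_const continuous_fst continuous_snd
  have hc : (0 : ℝ) < (4 * Real.pi * ħ * ε) ^ n := by positivity
  exact sqrtAlong_swap (F := fun τ u => regDet D ħ κt ε τ u)
      (F' := fun τ u => regDetDeriv D ħ κt ε τ u)
      (fun u τ => hasDerivAt_regDet D ħ κt ε u τ) h1 h2
      (fun τ u => regDet_ne_zero D hħ hε κt τ u) hc
      (fun u => regDet_self D ħ κt ε u) (fun τ u => regDet_swap D ħ κt ε τ u) t s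

/-- The squares alone would give this only up to sign; the sign is settled at each ε > 0 by
`sqrtAlong_regDet_swap` and survives the limit. -/
lemma sqrtDet_swap (D : Coeffs n) {ħ : ℝ} (hħ : 0 < ħ) (κt t s : ℝ)
    (hdet : (lam3 D κt t s).det ≠ 0) :
    sqrtDet D ħ κt s t = star (sqrtDet D ħ κt t s) := by
  obtain ⟨r, -, hlim⟩ := exists_tendsto_sqrtAlong_regDet D hħ κt t s hdet
  have h : Tendsto (fun ε => sqrtAlong (fun τ => regDet D ħ κt ε τ t) t s) (𝓝[>] 0)
      (𝓝 (star r)) := by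
    refine ((continuous_star.tendsto r).comp hlim).congr' ?_
    filter_upwards [self_mem_nhdsWithin] with ε hε
    exact (sqrtAlong_regDet_swap D hħ hε κt t s).symm
  rw [sqrtDet, sqrtDet, hlim.limUnder_eq, h.limUnder_eq]

/-- The modulus of the root is `√((2πħ)ⁿ |det λ₃|)`. -/
lemma norm_sqrtDet_sq (D : Coeffs n) {ħ : ℝ} (hħ : 0 < ħ) (κt t s : ℝ)
    (hdet : (lam3 D κt t s).det ≠ 0) :
    ‖sqrtDet D ħ κt t s‖ ^ 2 = (2 * Real.pi * ħ) ^ n * |(lam3 D κt t s).det| := by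
  rw [← norm_pow, sqrtDet_sq D hħ κt t s hdet]
  simp [abs_of_pos Real.pi_pos, abs_of_pos hħ]

end RegularizedDeterminant

section QuadraticPhase

open scoped SchwartzMap FourierTransform LineDeriv

/-! ### Oscillating factors -/

lemma hasTemperateGrowth_cexp_I_mul :
    Function.HasTemperateGrowth fun r : ℝ => Complex.exp (Complex.I * r) := by
  have hd : ∀ r : ℝ, HasDerivAt (fun r : ℝ => Complex.exp (Complex.I * r))
      (Complex.I * Complex.exp (Complex.I * r)) r := fun r => by
    have := ((Complex.ofRealCLM.hasDerivAt (x := r)).const_mul Complex.I).cexp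
    simpa [mul_comm] using this
  have hit : ∀ k, iteratedDeriv k (fun r : ℝ => Complex.exp (Complex.I * r)) =
      fun r : ℝ => Complex.I ^ k * Complex.exp (Complex.I * r) := by
    intro k
    induction k with
    | zero => simp
    | succ k ih =>
      rw [iteratedDeriv_succ, ih]
      funext r
      rw [((hd r).const_mul _).deriv]
      ring
  refine ⟨Complex.contDiff_exp.comp (contDiff_const.mul Complex.ofRealCLM.contDiff),
    fun k => ⟨0, 1, fun r => ?_⟩⟩
  rw [norm_iteratedFDeriv_eq_norm_iteratedDeriv, hit]
  simp [mul_comm Complex.I, Complex.norm_exp_ofReal_mul_I]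

variable {𝕍 : Type*} [NormedAddCommGroup 𝕍] [InnerProductSpace ℝ 𝕍]

/-- The factor `e^{iq}`. -/
noncomputable def phaseFactor {𝕍 : Type*} (q : 𝕍 → ℝ) (x : 𝕍) : ℂ := Complex.exp (Complex.I * q x)

lemma hasTemperateGrowth_phaseFactor {q : 𝕍 → ℝ} (hq : q.HasTemperateGrowth) :
    (phaseFactor q).HasTemperateGrowth :=
  hasTemperateGrowth_cexp_I_mul.comp hq

section

variable {n : ℕ}

/-- The quadratic polynomial `k + ⟨v, x - X⟩ + ½⟨x - X, Q (x - X)⟩`. -/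
noncomputable def quadPoly (k : ℝ) (v : Fin n → ℝ) (Q : Matrix (Fin n) (Fin n) ℝ) (X : Fin n → ℝ)
    (x : EuclideanSpace ℝ (Fin n)) : ℝ :=
  k + v ⬝ᵥ (fun j => x j - X j) + 1 / 2 * ((fun j => x j - X j) ⬝ᵥ (Q *ᵥ fun j => x j - X j))

lemma hasTemperateGrowth_coord (j : Fin n) :
    Function.HasTemperateGrowth fun x : EuclideanSpace ℝ (Fin n) => x j :=
  (EuclideanSpace.proj (𝕜 := ℝ) j).hasTemperateGrowth

lemma hasTemperateGrowth_quadPoly (k : ℝ) (v : Fin n → ℝ) (Q : Matrix (Fin n) (Fin n) ℝ)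
    (X : Fin n → ℝ) : (quadPoly k v Q X).HasTemperateGrowth := by
  have h : ∀ j, Function.HasTemperateGrowth fun x : EuclideanSpace ℝ (Fin n) => x j - X j := fun j =>
    (hasTemperateGrowth_coord j).sub (.const _)
  have h' : ∀ j, Function.HasTemperateGrowth fun x : EuclideanSpace ℝ (Fin n) =>
      (Q *ᵥ fun i => x i - X i) j := fun j =>
    (Function.HasTemperateGrowth.sum fun i _ =>
      (Function.HasTemperateGrowth.const (Q j i)).mul (h i) :
      Function.HasTemperateGrowth fun x : EuclideanSpace ℝ (Fin n) =>
        ∑ i, Q j i * (x i - X i))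
  have h1 : Function.HasTemperateGrowth fun x : EuclideanSpace ℝ (Fin n) => v ⬝ᵥ (fun j => x j - X j) :=
    Function.HasTemperateGrowth.sum fun j _ => (Function.HasTemperateGrowth.const (v j)).mul (h j)
  have h2 : Function.HasTemperateGrowth fun x : EuclideanSpace ℝ (Fin n) =>
      (fun j => x j - X j) ⬝ᵥ (Q *ᵥ fun j => x j - X j) :=
    Function.HasTemperateGrowth.sum fun j _ => (h j).mul (h' j)
  exact ((Function.HasTemperateGrowth.const k).add h1).add
    ((Function.HasTemperateGrowth.const (1 / 2 : ℝ)).mul h2)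

lemma hasLineDerivAt_quadPoly (k : ℝ) (v : Fin n → ℝ) {Q : Matrix (Fin n) (Fin n) ℝ}
    (hQ : Q.IsSymm) (X : Fin n → ℝ) (x m : EuclideanSpace ℝ (Fin n)) :
    HasLineDerivAt ℝ (quadPoly k v Q X)
      (v ⬝ᵥ m.ofLp + m.ofLp ⬝ᵥ (Q *ᵥ fun j => x j - X j)) x m := by
  have h : ∀ j, HasDerivAt (fun τ : ℝ => (x + τ • m) j - X j) (m j) 0 := fun j => by
    have := ((hasDerivAt_id (0 : ℝ)).mul_const (m j)).const_add (x j)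
    simpa using this.sub_const (X j)
  have h1 : HasDerivAt (fun τ : ℝ => v ⬝ᵥ (fun j => (x + τ • m) j - X j)) (v ⬝ᵥ m.ofLp) 0 :=
    HasDerivAt.fun_sum fun j _ => (h j).const_mul (v j)
  have h2 : ∀ j, HasDerivAt (fun τ : ℝ => (Q *ᵥ fun j => (x + τ • m) j - X j) j)
      ((Q *ᵥ m.ofLp) j) 0 := fun j =>
    (HasDerivAt.fun_sum fun i _ => (h i).const_mul (Q j i) :
      HasDerivAt (fun τ : ℝ => ∑ i, Q j i * ((x + τ • m) i - X i)) (∑ i, Q j i * m i) 0)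
  have h3 : HasDerivAt (fun τ : ℝ => (fun j => (x + τ • m) j - X j) ⬝ᵥ
      (Q *ᵥ fun j => (x + τ • m) j - X j))
      (∑ j, (m j * (Q *ᵥ fun j => (x + (0 : ℝ) • m) j - X j) j +
        ((x + (0 : ℝ) • m) j - X j) * (Q *ᵥ m.ofLp) j)) 0 :=
    HasDerivAt.fun_sum fun j _ => (h j).mul (h2 j)
  refine ((h1.const_add k).add (h3.const_mul (1 / 2))).congr_deriv ?_
  have hsymm : (fun j => x j - X j) ⬝ᵥ (Q *ᵥ m.ofLp) =
      m.ofLp ⬝ᵥ (Q *ᵥ fun j => x j - X j) := by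
    rw [dotProduct_comm, ← Matrix.vecMul_transpose, hQ.eq, ← Matrix.dotProduct_mulVec]
  rw [Finset.sum_add_distrib]
  simp only [zero_smul, add_zero]
  change v ⬝ᵥ m.ofLp + 1 / 2 * (m.ofLp ⬝ᵥ (Q *ᵥ fun j => x j - X j) +
    (fun j => x j - X j) ⬝ᵥ (Q *ᵥ m.ofLp)) = _
  rw [hsymm]
  ring

end

lemma star_phaseFactor_mul {𝕍 : Type*} (q : 𝕍 → ℝ) (x : 𝕍) :
    star (phaseFactor q x) * phaseFactor q x = 1 := by
  rw [phaseFactor, Complex.star_def, ← Complex.exp_conj, ← Complex.exp_add]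
  simp

lemma hasLineDerivAt_phaseFactor_mul {q : 𝕍 → ℝ} {q' : ℝ} {f : 𝕍 → ℂ} {f' : ℂ} {x m : 𝕍}
    (hq : HasLineDerivAt ℝ q q' x m) (hf : HasLineDerivAt ℝ f f' x m) :
    HasLineDerivAt ℝ (fun x => phaseFactor q x * f x)
      (phaseFactor q x * (Complex.I * q' * f x + f')) x m := by
  have h := ((hq.ofReal_comp.const_mul Complex.I).cexp).mul hf
  refine HasDerivAt.congr_deriv h ?_
  simp only [phaseFactor, zero_smul, add_zero]
  ring

lemma hasLineDerivAt_schwartz (f : 𝓢(𝕍, ℂ)) (x m : 𝕍) :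
    HasLineDerivAt ℝ f ((∂_{m} f : 𝓢(𝕍, ℂ)) x) x m := by
  rw [SchwartzMap.lineDerivOp_apply_eq_fderiv]
  exact f.differentiableAt.hasFDerivAt.hasLineDerivAt m

/-! ### Fourier integral operators with quadratic phase -/

variable [FiniteDimensional ℝ 𝕍] [MeasurableSpace 𝕍] [BorelSpace 𝕍]

/-- `f ↦ c e^{ia(x)} ∫ e^{-2πi⟨y, Lx⟩} e^{ib(y)} f(y) dy` on Schwartz functions. -/
noncomputable def quadFourier (c : ℂ) (a b : 𝕍 → ℝ) (L : 𝕍 ≃L[ℝ] 𝕍) : 𝓢(𝕍, ℂ) →L[ℂ] 𝓢(𝕍, ℂ) :=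
  c • (SchwartzMap.smulLeftCLM ℂ (phaseFactor a) ∘L
    SchwartzMap.compCLMOfContinuousLinearEquiv ℂ L ∘L
    FourierTransform.fourierCLM ℂ 𝓢(𝕍, ℂ) ∘L SchwartzMap.smulLeftCLM ℂ (phaseFactor b))

variable {c : ℂ} {a b : 𝕍 → ℝ} {L : 𝕍 ≃L[ℝ] 𝕍}

lemma quadFourier_apply (ha : a.HasTemperateGrowth) (f : 𝓢(𝕍, ℂ)) (x : 𝕍) :
    quadFourier c a b L f x =
      c * (phaseFactor a x * 𝓕 (SchwartzMap.smulLeftCLM ℂ (phaseFactor b) f) (L x)) := by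
  simp [quadFourier, hasTemperateGrowth_phaseFactor ha]

lemma quadFourier_eq_integral (ha : a.HasTemperateGrowth) (hb : b.HasTemperateGrowth)
    (f : 𝓢(𝕍, ℂ)) (x : 𝕍) :
    quadFourier c a b L f x = ∫ y, c * Complex.exp
      (Complex.I * ((a x + b y - 2 * Real.pi * inner ℝ y (L x) : ℝ) : ℂ)) * f y := by
  rw [quadFourier_apply ha, SchwartzMap.fourier_coe, Real.fourier_eq', ← integral_const_mul,
    ← integral_const_mul]
  refine integral_congr_ae (Eventually.of_forall fun y => ?_)
  simp only [SchwartzMap.smulLeftCLM_apply_apply (hasTemperateGrowth_phaseFactor hb), smul_eq_mul,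
    phaseFactor]
  have : Complex.exp (Complex.I * ((a x + b y - 2 * Real.pi * inner ℝ y (L x) : ℝ) : ℂ)) =
      Complex.exp (Complex.I * a x) * Complex.exp ((-2 * Real.pi * inner ℝ y (L x) : ℝ) *
        Complex.I) * Complex.exp (Complex.I * b y) := by
    rw [← Complex.exp_add, ← Complex.exp_add]
    congr 1
    push_cast
    ring
  rw [this]
  ring

lemma integral_comp_clEquiv {F : Type*} [NormedAddCommGroup F] [NormedSpace ℝ F] (h : 𝕍 → F) :
    ∫ x, h (L x) = |(LinearMap.det (L : 𝕍 →ₗ[ℝ] 𝕍))⁻¹| • ∫ x, h x := by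
  have hdet : LinearMap.det (L : 𝕍 →ₗ[ℝ] 𝕍) ≠ 0 := L.toLinearEquiv.isUnit_det'.ne_zero
  have hm := Measure.map_linearMap_addHaar_eq_smul_addHaar (volume : Measure 𝕍) hdet
  have h1 := L.toHomeomorph.measurableEmbedding.integral_map (μ := volume) h
  change ∫ y, h y ∂(Measure.map (L : 𝕍 →ₗ[ℝ] 𝕍) volume) = ∫ x, h (L x) at h1
  rw [← h1, hm, integral_smul_measure, ENNReal.toReal_ofReal (abs_nonneg _)]

/-- Plancherel's formula for `quadFourier`. -/
lemma integral_star_quadFourier_mul (ha : a.HasTemperateGrowth) (hb : b.HasTemperateGrowth)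
    (hc : ‖c‖ ^ 2 = |LinearMap.det (L : 𝕍 →ₗ[ℝ] 𝕍)|) (f g : 𝓢(𝕍, ℂ)) :
    ∫ x, star (quadFourier c a b L f x) * quadFourier c a b L g x = ∫ x, star (f x) * g x := by
  have hdet : LinearMap.det (L : 𝕍 →ₗ[ℝ] 𝕍) ≠ 0 := L.toLinearEquiv.isUnit_det'.ne_zero
  set F := SchwartzMap.smulLeftCLM ℂ (phaseFactor b) f
  set G := SchwartzMap.smulLeftCLM ℂ (phaseFactor b) g
  have hcc : star c * c = ((‖c‖ ^ 2 : ℝ) : ℂ) := by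
    rw [Complex.star_def, Complex.conj_mul']; simp
  have h1 : ∀ x, star (quadFourier c a b L f x) * quadFourier c a b L g x =
      ((‖c‖ ^ 2 : ℝ) : ℂ) * (star (𝓕 F (L x)) * 𝓕 G (L x)) := fun x => by
    rw [quadFourier_apply ha, quadFourier_apply ha, ← hcc, star_mul', star_mul']
    linear_combination (star c * c * star (𝓕 F (L x)) * 𝓕 G (L x)) * star_phaseFactor_mul a x
  have h2 : ∫ x, star (𝓕 F x) * 𝓕 G x = ∫ x, star (F x) * G x := by
    simpa [RCLike.inner_apply, mul_comm] using SchwartzMap.integral_inner_fourier_fourier F G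
  simp_rw [h1]
  rw [integral_const_mul, integral_comp_clEquiv (L := L) fun x => star (𝓕 F x) * 𝓕 G x, h2, hc,
    Complex.real_smul, ← mul_assoc, ← Complex.ofReal_mul, abs_inv,
    mul_inv_cancel₀ (abs_ne_zero.2 hdet), Complex.ofReal_one, one_mul]
  refine integral_congr_ae (Eventually.of_forall fun x => ?_)
  simp only [F, G, SchwartzMap.smulLeftCLM_apply_apply (hasTemperateGrowth_phaseFactor hb),
    smul_eq_mul, star_mul']
  linear_combination (star (f x) * g x) * star_phaseFactor_mul b x

/-- The integral operator with the adjoint kernel inverts `quadFourier`. -/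
lemma integral_adjoint_quadFourier (ha : a.HasTemperateGrowth) (hb : b.HasTemperateGrowth)
    (hc : ‖c‖ ^ 2 = |LinearMap.det (L : 𝕍 →ₗ[ℝ] 𝕍)|) (f : 𝓢(𝕍, ℂ)) (x : 𝕍) :
    ∫ y, star c * Complex.exp (-(Complex.I *
      ((a y + b x - 2 * Real.pi * inner ℝ x (L y) : ℝ) : ℂ))) * quadFourier c a b L f y = f x := by
  have hdet : LinearMap.det (L : 𝕍 →ₗ[ℝ] 𝕍) ≠ 0 := L.toLinearEquiv.isUnit_det'.ne_zero
  set F := SchwartzMap.smulLeftCLM ℂ (phaseFactor b) f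
  have hcc : star c * c = ((‖c‖ ^ 2 : ℝ) : ℂ) := by
    rw [Complex.star_def, Complex.conj_mul']; simp
  have h1 : ∀ y, star c * Complex.exp (-(Complex.I *
      ((a y + b x - 2 * Real.pi * inner ℝ x (L y) : ℝ) : ℂ))) * quadFourier c a b L f y =
      (((‖c‖ ^ 2 : ℝ) : ℂ) * star (phaseFactor b x)) *
        (Complex.exp ((2 * Real.pi * inner ℝ (L y) x : ℝ) * Complex.I) * 𝓕 F (L y)) := fun y => by
    have : Complex.exp (-(Complex.I * ((a y + b x - 2 * Real.pi * inner ℝ x (L y) : ℝ) : ℂ))) =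
        star (phaseFactor a y) * star (phaseFactor b x) *
          Complex.exp ((2 * Real.pi * inner ℝ (L y) x : ℝ) * Complex.I) := by
      simp only [phaseFactor, Complex.star_def, ← Complex.exp_conj]
      rw [← Complex.exp_add, ← Complex.exp_add, real_inner_comm]
      congr 1
      simp
      ring
    rw [this, quadFourier_apply ha, ← hcc]
    linear_combination (star c * c * star (phaseFactor b x) *
      Complex.exp ((2 * Real.pi * inner ℝ (L y) x : ℝ) * Complex.I) * 𝓕 F (L y)) *
        star_phaseFactor_mul a y
  -- Fourier inversion, after the outer phase has cancelled against its conjugate.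
  have h2 : ∫ ξ, Complex.exp ((2 * Real.pi * inner ℝ ξ x : ℝ) * Complex.I) * 𝓕 F ξ = F x := by
    have : 𝓕⁻ (𝓕 F) x = F x := by rw [FourierTransform.fourierInv_fourier_eq]
    rw [SchwartzMap.fourierInv_coe, Real.fourierInv_eq'] at this
    simpa using this
  simp_rw [h1]
  rw [integral_const_mul, integral_comp_clEquiv (L := L) fun ξ =>
    Complex.exp ((2 * Real.pi * inner ℝ ξ x : ℝ) * Complex.I) * 𝓕 F ξ, h2, hc,
    Complex.real_smul]
  simp only [F, SchwartzMap.smulLeftCLM_apply_apply (hasTemperateGrowth_phaseFactor hb),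
    smul_eq_mul]
  have h3 : ((|LinearMap.det (L : 𝕍 →ₗ[ℝ] 𝕍)| : ℝ) : ℂ) *
      ((|(LinearMap.det (L : 𝕍 →ₗ[ℝ] 𝕍))⁻¹| : ℝ) : ℂ) = 1 := by
    rw [← Complex.ofReal_mul, abs_inv, mul_inv_cancel₀ (abs_ne_zero.2 hdet), Complex.ofReal_one]
  linear_combination (star (phaseFactor b x) * phaseFactor b x * f x) * h3 +
    f x * star_phaseFactor_mul b x

/-- Multiplication by a linear function after `quadFourier`. -/
lemma inner_mul_quadFourier (ha : a.HasTemperateGrowth) (hb : b.HasTemperateGrowth) {m : 𝕍}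
    {b' : 𝕍 → ℝ} (hb' : ∀ y, HasLineDerivAt ℝ b (b' y) y m) (hb't : b'.HasTemperateGrowth)
    (f : 𝓢(𝕍, ℂ)) (x : 𝕍) :
    2 * Real.pi * Complex.I * (inner ℝ (L x) m : ℝ) * quadFourier c a b L f x =
      quadFourier c a b L (Complex.I • SchwartzMap.smulLeftCLM ℂ (fun y => (b' y : ℂ)) f +
        ∂_{m} f) x := by
  have hin : (inner ℝ · m : 𝕍 → ℝ).HasTemperateGrowth := by fun_prop
  have hb't' : Function.HasTemperateGrowth fun y => (b' y : ℂ) :=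
    Complex.ofRealCLM.hasTemperateGrowth.comp hb't
  -- The bracket is e^{-ib} ∂_m(e^{ib} f), and the Fourier transform turns ∂_m into multiplication
  -- by the frequency.
  have h : SchwartzMap.smulLeftCLM ℂ (phaseFactor b)
      (Complex.I • SchwartzMap.smulLeftCLM ℂ (fun y => (b' y : ℂ)) f + ∂_{m} f) =
      ∂_{m} (SchwartzMap.smulLeftCLM ℂ (phaseFactor b) f) := by
    ext y
    rw [SchwartzMap.lineDerivOp_apply, SchwartzMap.smulLeftCLM_apply
      (hasTemperateGrowth_phaseFactor hb) f]
    simp only [smul_eq_mul]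
    rw [(hasLineDerivAt_phaseFactor_mul (hb' y) (hasLineDerivAt_schwartz f y m)).lineDeriv]
    simp [SchwartzMap.smulLeftCLM_apply_apply hb't',
      SchwartzMap.smulLeftCLM_apply_apply (hasTemperateGrowth_phaseFactor hb)]
    ring
  rw [quadFourier_apply ha, quadFourier_apply ha, h, SchwartzMap.fourier_lineDerivOp_eq]
  simp [hin]
  ring

/-- Differentiation after `quadFourier`. -/
lemma lineDeriv_quadFourier (ha : a.HasTemperateGrowth) (hb : b.HasTemperateGrowth) {m x : 𝕍} {a' : ℝ}
    (ha' : HasLineDerivAt ℝ a a' x m) (f : 𝓢(𝕍, ℂ)) :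
    (∂_{m} (quadFourier c a b L f) : 𝓢(𝕍, ℂ)) x = Complex.I * a' * quadFourier c a b L f x -
      2 * Real.pi * Complex.I * quadFourier c a b L
        (SchwartzMap.smulLeftCLM ℂ (fun y => ((inner ℝ y (L m) : ℝ) : ℂ)) f) x := by
  have hin : (inner ℝ · (L m) : 𝕍 → ℝ).HasTemperateGrowth := by fun_prop
  have hin' : Function.HasTemperateGrowth fun y => ((inner ℝ y (L m) : ℝ) : ℂ) :=
    Complex.ofRealCLM.hasTemperateGrowth.comp hin
  set F := SchwartzMap.smulLeftCLM ℂ (phaseFactor b) f with hF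
  have hcomm : SchwartzMap.smulLeftCLM ℂ (phaseFactor b)
      (SchwartzMap.smulLeftCLM ℂ (fun y => ((inner ℝ y (L m) : ℝ) : ℂ)) f) =
      SchwartzMap.smulLeftCLM ℂ (fun y => (inner ℝ y (L m) : ℝ)) F := by
    ext y
    rw [SchwartzMap.smulLeftCLM_apply_apply hin,
      SchwartzMap.smulLeftCLM_apply_apply (hasTemperateGrowth_phaseFactor hb),
      SchwartzMap.smulLeftCLM_apply_apply hin', hF,
      SchwartzMap.smulLeftCLM_apply_apply (hasTemperateGrowth_phaseFactor hb)]
    simp only [smul_eq_mul, Complex.real_smul]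
    ring
  have hH := hasLineDerivAt_schwartz
    (SchwartzMap.compCLMOfContinuousLinearEquiv ℂ L (𝓕 F)) x m
  rw [SchwartzMap.lineDerivOp_compCLMOfContinuousLinearEquiv,
    SchwartzMap.lineDerivOp_fourier_eq, ← hcomm] at hH
  have h1 := HasDerivAt.const_mul c (hasLineDerivAt_phaseFactor_mul ha' hH)
  have h2 : (quadFourier c a b L f : 𝕍 → ℂ) = fun x => c * (phaseFactor a x *
      SchwartzMap.compCLMOfContinuousLinearEquiv ℂ L (𝓕 F) x) := by
    funext y
    rw [quadFourier_apply ha]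
    rfl
  have h3 : HasLineDerivAt ℝ (fun x => c * (phaseFactor a x *
      SchwartzMap.compCLMOfContinuousLinearEquiv ℂ L (𝓕 F) x)) _ x m := h1
  rw [← h2] at h3
  rw [SchwartzMap.lineDerivOp_apply, h3.lineDeriv, quadFourier_apply ha, quadFourier_apply ha, ← hF]
  simp [FourierTransform.fourier_smul]
  ring

end QuadraticPhase

section CanonicalOperators

open scoped SchwartzMap FourierTransform LineDeriv

variable {n : ℕ}

/-! ### The canonical operators on Schwartz functions -/

/-- The operators `ẑ - z` on Schwartz functions. -/
noncomputable def dzSchwartz (ħ : ℝ) (z : PhaseVec n) :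
    Fin n ⊕ Fin n → 𝓢(EuclideanSpace ℝ (Fin n), ℂ) →L[ℂ] 𝓢(EuclideanSpace ℝ (Fin n), ℂ)
  | Sum.inl j => (-Complex.I * ħ) • LineDeriv.lineDerivOpCLM ℂ _ (EuclideanSpace.single j (1 : ℝ)) -
      (z (Sum.inl j) : ℂ) • ContinuousLinearMap.id ℂ _
  | Sum.inr j => SchwartzMap.smulLeftCLM ℂ (fun x => (x j : ℂ)) -
      (z (Sum.inr j) : ℂ) • ContinuousLinearMap.id ℂ _

lemma hasTemperateGrowth_coord_ofReal (j : Fin n) :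
    Function.HasTemperateGrowth fun x : EuclideanSpace ℝ (Fin n) => (x j : ℂ) :=
  Complex.ofRealCLM.hasTemperateGrowth.comp (hasTemperateGrowth_coord j)

lemma dzSchwartz_inl_apply (ħ : ℝ) (z : PhaseVec n) (j : Fin n)
    (f : 𝓢(EuclideanSpace ℝ (Fin n), ℂ)) (x : EuclideanSpace ℝ (Fin n)) :
    dzSchwartz ħ z (Sum.inl j) f x =
      -Complex.I * ħ * (∂_{EuclideanSpace.single j (1 : ℝ)} f : 𝓢(_, ℂ)) x -
        z (Sum.inl j) * f x := by
  simp [dzSchwartz]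

lemma dzSchwartz_inr_apply (ħ : ℝ) (z : PhaseVec n) (j : Fin n)
    (f : 𝓢(EuclideanSpace ℝ (Fin n), ℂ)) (x : EuclideanSpace ℝ (Fin n)) :
    dzSchwartz ħ z (Sum.inr j) f x = ((x j : ℂ) - z (Sum.inr j)) * f x := by
  simp [dzSchwartz, SchwartzMap.smulLeftCLM_apply_apply (hasTemperateGrowth_coord_ofReal j),
    sub_mul]

lemma coe_dzSchwartz (ħ : ℝ) (z : PhaseVec n) (k : Fin n ⊕ Fin n)
    (f : 𝓢(EuclideanSpace ℝ (Fin n), ℂ)) : ⇑(dzSchwartz ħ z k f) = dzOp ħ z k f := by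
  funext x
  rcases k with j | j
  · rw [dzSchwartz_inl_apply, SchwartzMap.lineDerivOp_apply_eq_fderiv]; rfl
  · rw [dzSchwartz_inr_apply, sub_mul]; rfl

/-! ### Kernels with a quadratic phase -/

section Kernel

variable (ħ S : ℝ) (Pt Xt Ps Xs : Fin n → ℝ) (R Q₁ Q₂ : Matrix (Fin n) (Fin n) ℝ)

/-- The part of the phase that depends on `x`. -/
noncomputable def outerPhase : EuclideanSpace ℝ (Fin n) → ℝ :=
  quadPoly (S / ħ) (ħ⁻¹ • (Pt - R *ᵥ Xs)) (-(ħ⁻¹ • Q₂)) Xt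

/-- The part of the phase that depends on `y`. -/
noncomputable def innerPhase : EuclideanSpace ℝ (Fin n) → ℝ :=
  quadPoly (-ħ⁻¹ * (Xt ⬝ᵥ (R *ᵥ Xs))) (ħ⁻¹ • (-Ps - Xt ᵥ* R)) (-(ħ⁻¹ • Q₁)) Xs

/-- The frequency `-(2πħ)⁻¹ Rᵀ x`. -/
noncomputable def frequencyMap : EuclideanSpace ℝ (Fin n) →ₗ[ℝ] EuclideanSpace ℝ (Fin n) :=
  Matrix.toEuclideanLin (-(2 * Real.pi * ħ)⁻¹ • Rᵀ)

lemma det_frequencyMap :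
    LinearMap.det (frequencyMap ħ R) = (-(2 * Real.pi * ħ)⁻¹) ^ n * R.det := by
  have : frequencyMap ħ R = Matrix.toLin (EuclideanSpace.basisFun (Fin n) ℝ).toBasis
      (EuclideanSpace.basisFun (Fin n) ℝ).toBasis (-(2 * Real.pi * ħ)⁻¹ • Rᵀ) := rfl
  rw [this, LinearMap.det_toLin, Matrix.det_smul, Matrix.det_transpose, Fintype.card_fin]

lemma frequencyMap_apply (x : EuclideanSpace ℝ (Fin n)) :
    (frequencyMap ħ R x).ofLp = -(2 * Real.pi * ħ)⁻¹ • (x.ofLp ᵥ* R) := by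
  change (-(2 * Real.pi * ħ)⁻¹ • Rᵀ) *ᵥ x.ofLp = _
  rw [Matrix.smul_mulVec, Matrix.mulVec_transpose]

lemma inner_frequencyMap (y x : EuclideanSpace ℝ (Fin n)) :
    inner ℝ y (frequencyMap ħ R x) = -(2 * Real.pi * ħ)⁻¹ * (x.ofLp ⬝ᵥ (R *ᵥ y.ofLp)) := by
  rw [EuclideanSpace.inner_eq_star_dotProduct, frequencyMap_apply, smul_dotProduct,
    Matrix.dotProduct_mulVec]
  rfl

variable {ħ R} in
lemma det_frequencyMap_ne_zero (hħ : 0 < ħ) (hR : R.det ≠ 0) :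
    LinearMap.det (frequencyMap ħ R) ≠ 0 := by
  rw [det_frequencyMap]
  exact mul_ne_zero (pow_ne_zero _ (neg_ne_zero.2 (inv_ne_zero (by positivity)))) hR

variable {ħ R} in
noncomputable def frequencyEquiv (hħ : 0 < ħ) (hR : R.det ≠ 0) :
    EuclideanSpace ℝ (Fin n) ≃L[ℝ] EuclideanSpace ℝ (Fin n) :=
  ((frequencyMap ħ R).equivOfDetNeZero (det_frequencyMap_ne_zero hħ hR)).toContinuousLinearEquiv

variable {ħ R}

lemma frequencyEquiv_apply (hħ : 0 < ħ) (hR : R.det ≠ 0) (x : EuclideanSpace ℝ (Fin n)) :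
    frequencyEquiv hħ hR x = frequencyMap ħ R x := rfl

lemma det_frequencyEquiv (hħ : 0 < ħ) (hR : R.det ≠ 0) :
    LinearMap.det (frequencyEquiv hħ hR : EuclideanSpace ℝ (Fin n) →ₗ[ℝ] _) =
      (-(2 * Real.pi * ħ)⁻¹) ^ n * R.det := by
  rw [← det_frequencyMap]
  congr 1

lemma hasTemperateGrowth_outerPhase : (outerPhase ħ S Pt Xt Xs R Q₂).HasTemperateGrowth :=
  hasTemperateGrowth_quadPoly _ _ _ _

lemma hasTemperateGrowth_innerPhase : (innerPhase ħ Xt Ps Xs R Q₁).HasTemperateGrowth :=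
  hasTemperateGrowth_quadPoly _ _ _ _

/-- The sum of the parts is the full quadratic phase. -/
lemma outerPhase_add_innerPhase (hħ : 0 < ħ) (hR : R.det ≠ 0) (x y : EuclideanSpace ℝ (Fin n)) :
    outerPhase ħ S Pt Xt Xs R Q₂ x + innerPhase ħ Xt Ps Xs R Q₁ y -
      2 * Real.pi * inner ℝ y (frequencyEquiv hħ hR x) =
    ħ⁻¹ * (S + Pt ⬝ᵥ (fun j => x j - Xt j) - Ps ⬝ᵥ (fun j => y j - Xs j)
      - 1 / 2 * ((fun j => y j - Xs j) ⬝ᵥ (Q₁ *ᵥ fun j => y j - Xs j))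
      + (fun j => x j - Xt j) ⬝ᵥ (R *ᵥ fun j => y j - Xs j)
      - 1 / 2 * ((fun j => x j - Xt j) ⬝ᵥ (Q₂ *ᵥ fun j => x j - Xt j))) := by
  have hx : (fun j => x j - Xt j) = x.ofLp - Xt := rfl
  have hy : (fun j => y j - Xs j) = y.ofLp - Xs := rfl
  have hπ := Real.pi_ne_zero
  rw [frequencyEquiv_apply, inner_frequencyMap, outerPhase, innerPhase, quadPoly, quadPoly, hx, hy]
  simp only [smul_dotProduct, Matrix.neg_mulVec, dotProduct_neg, Matrix.smul_mulVec,
    dotProduct_smul, smul_eq_mul, sub_dotProduct, neg_dotProduct, dotProduct_sub,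
    Matrix.mulVec_sub, ← Matrix.dotProduct_mulVec]
  rw [dotProduct_comm (R *ᵥ Xs) x.ofLp, dotProduct_comm (R *ᵥ Xs) Xt]
  field_simp
  ring

variable {Q₁ Q₂} {c : ℂ}

/-- Integration by parts in y: the y-gradient of ħ times the phase is -Ps - Q₁Δy + RᵀΔx, so moving
p̂ from f onto the kernel gives RᵀΔx T f = Q₁ T(Δy f) - T((p̂ - Ps) f). -/
lemma sum_smul_dzSchwartz_inr (hħ : 0 < ħ) (hR : R.det ≠ 0) (hQ₁ : Q₁.IsSymm)
    {zt zs : PhaseVec n} (f : 𝓢(EuclideanSpace ℝ (Fin n), ℂ)) (j : Fin n)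
    (x : EuclideanSpace ℝ (Fin n)) :
    let T := quadFourier c
      (outerPhase ħ S (fun i => zt (.inl i)) (fun i => zt (.inr i)) (fun i => zs (.inr i)) R Q₂)
      (innerPhase ħ (fun i => zt (.inr i)) (fun i => zs (.inl i)) (fun i => zs (.inr i)) R Q₁)
      (frequencyEquiv hħ hR)
    ∑ i, (R i j : ℂ) * dzSchwartz ħ zt (.inr i) (T f) x =
      ∑ i, (Q₁ j i : ℂ) * T (dzSchwartz ħ zs (.inr i) f) x - T (dzSchwartz ħ zs (.inl j) f) x := by
  intro T
  set Xt : Fin n → ℝ := fun i => zt (.inr i)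
  set Ps : Fin n → ℝ := fun i => zs (.inl i)
  set Xs : Fin n → ℝ := fun i => zs (.inr i)
  obtain ⟨m, hm⟩ : ∃ m : EuclideanSpace ℝ (Fin n), m = EuclideanSpace.single j 1 := ⟨_, rfl⟩
  have hm' : m.ofLp = Pi.single j 1 := by rw [hm]; rfl
  set b' : EuclideanSpace ℝ (Fin n) → ℝ := fun y =>
    ħ⁻¹ * (-Ps j - (Xt ᵥ* R) j - ∑ i, Q₁ j i * (y i - Xs i))
  have hb' : ∀ y, HasLineDerivAt ℝ (innerPhase ħ Xt Ps Xs R Q₁) (b' y) y m := fun y => by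
    refine HasDerivAt.congr_deriv (hasLineDerivAt_quadPoly _ _ ?_ Xs y m) ?_
    · exact (hQ₁.smul _).neg
    · rw [hm', dotProduct_single_one, single_one_dotProduct, Matrix.neg_mulVec,
        Matrix.smul_mulVec]
      change ħ⁻¹ * _ + -(ħ⁻¹ * _) = ħ⁻¹ * _
      rw [← mul_neg, ← mul_add, ← sub_eq_add_neg]
      rfl
  have hb't : b'.HasTemperateGrowth := by
    refine (Function.HasTemperateGrowth.const _).mul ((Function.HasTemperateGrowth.const _).sub
      (Function.HasTemperateGrowth.sum fun i _ => (Function.HasTemperateGrowth.const _).mul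
        ((hasTemperateGrowth_coord i).sub (.const _))))
  have hb't' : Function.HasTemperateGrowth fun y => (b' y : ℂ) :=
    Complex.ofRealCLM.hasTemperateGrowth.comp hb't
  have hħ' : (ħ : ℂ) ≠ 0 := Complex.ofReal_ne_zero.2 hħ.ne'
  have hmain := inner_mul_quadFourier (c := c) (L := frequencyEquiv hħ hR) (m := m)
    (hasTemperateGrowth_outerPhase S (fun i => zt (.inl i)) Xt Xs (R := R) (ħ := ħ) Q₂)
    (hasTemperateGrowth_innerPhase Xt Ps Xs Q₁) hb' hb't f x
  -- The last term compensates the part -⟨Xt, R(y - Xs)⟩ of the cross term, which `innerPhase` has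
  -- absorbed.
  have hvec : ∑ i, (Q₁ j i : ℂ) • dzSchwartz ħ zs (.inr i) f - dzSchwartz ħ zs (.inl j) f =
      (Complex.I * ħ) • (Complex.I • SchwartzMap.smulLeftCLM ℂ (fun y => (b' y : ℂ)) f +
        ∂_{m} f) - ((Xt ᵥ* R) j : ℂ) • f := by
    ext y
    simp only [_root_.sub_apply, _root_.sum_apply, _root_.smul_apply,
      _root_.add_apply, dzSchwartz_inr_apply, dzSchwartz_inl_apply, smul_eq_mul,
      SchwartzMap.smulLeftCLM_apply_apply hb't']
    have hby : (ħ : ℂ) * b' y = -(zs (.inl j) : ℂ) - ((Xt ᵥ* R) j : ℝ) -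
        ∑ i, (Q₁ j i : ℂ) * ((y i : ℂ) - zs (.inr i)) := by
      simp only [b']
      push_cast
      rw [mul_inv_cancel_left₀ hħ']
    simp only [← mul_assoc, ← Finset.sum_mul]
    rw [← hm]
    linear_combination f y * hby - (ħ * b' y * f y) * Complex.I_sq
  have hin : inner ℝ (frequencyEquiv hħ hR x) m = -(2 * Real.pi * ħ)⁻¹ * (x.ofLp ᵥ* R) j := by
    rw [real_inner_comm, frequencyEquiv_apply, inner_frequencyMap, Matrix.dotProduct_mulVec]
    simp [hm']
  have hT := congrArg (fun u => T u x) hvec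
  simp only [map_sub, map_sum, map_smul, _root_.sub_apply, _root_.sum_apply,
    _root_.smul_apply, smul_eq_mul] at hT
  rw [hT]
  change _ = Complex.I * ħ * quadFourier c (outerPhase ħ S _ Xt Xs R Q₂) _ _ _ x - _
  rw [← hmain, hin]
  simp only [dzSchwartz_inr_apply, ← mul_assoc, ← Finset.sum_mul]
  have h1 : ∑ i, (R i j : ℂ) * ((x i : ℂ) - zt (.inr i)) =
      ((x.ofLp ᵥ* R) j : ℝ) - ((Xt ᵥ* R) j : ℝ) := by
    simp only [Matrix.vecMul, dotProduct, Xt]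
    push_cast
    rw [← Finset.sum_sub_distrib]
    exact Finset.sum_congr rfl fun i _ => by ring
  have hπ : (Real.pi : ℂ) ≠ 0 := Complex.ofReal_ne_zero.2 Real.pi_ne_zero
  have h2 : ((-(2 * Real.pi * ħ)⁻¹ * (x.ofLp ᵥ* R) j : ℝ) : ℂ) * (2 * Real.pi * ħ) =
      -((x.ofLp ᵥ* R) j : ℝ) := by
    push_cast
    field_simp
  rw [h1]
  linear_combination T f x * h2 - (((-(2 * Real.pi * ħ)⁻¹ * (x.ofLp ᵥ* R) j : ℝ) : ℂ) *
    (2 * Real.pi * ħ) * T f x) * Complex.I_sq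

/-- Differentiation under the integral: the x-gradient of ħ times the phase is Pt - Q₂Δx + RΔy. -/
lemma dzSchwartz_inl_quadFourier (hħ : 0 < ħ) (hR : R.det ≠ 0) (hQ₂ : Q₂.IsSymm)
    {zt zs : PhaseVec n} (f : 𝓢(EuclideanSpace ℝ (Fin n), ℂ)) (j : Fin n)
    (x : EuclideanSpace ℝ (Fin n)) :
    let T := quadFourier c
      (outerPhase ħ S (fun i => zt (.inl i)) (fun i => zt (.inr i)) (fun i => zs (.inr i)) R Q₂)
      (innerPhase ħ (fun i => zt (.inr i)) (fun i => zs (.inl i)) (fun i => zs (.inr i)) R Q₁)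
      (frequencyEquiv hħ hR)
    dzSchwartz ħ zt (.inl j) (T f) x =
      -∑ i, (Q₂ j i : ℂ) * dzSchwartz ħ zt (.inr i) (T f) x +
        ∑ i, (R j i : ℂ) * T (dzSchwartz ħ zs (.inr i) f) x := by
  intro T
  set Pt : Fin n → ℝ := fun i => zt (.inl i)
  set Xt : Fin n → ℝ := fun i => zt (.inr i)
  set Ps : Fin n → ℝ := fun i => zs (.inl i)
  set Xs : Fin n → ℝ := fun i => zs (.inr i)
  obtain ⟨m, hm⟩ : ∃ m : EuclideanSpace ℝ (Fin n), m = EuclideanSpace.single j 1 := ⟨_, rfl⟩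
  have hm' : m.ofLp = Pi.single j 1 := by rw [hm]; rfl
  set a' : ℝ := ħ⁻¹ * (Pt j - (R *ᵥ Xs) j - ∑ i, Q₂ j i * (x i - Xt i)) with ha'_def
  have ha' : HasLineDerivAt ℝ (outerPhase ħ S Pt Xt Xs R Q₂) a' x m := by
    refine HasDerivAt.congr_deriv (hasLineDerivAt_quadPoly _ _ ?_ Xt x m) ?_
    · exact (hQ₂.smul _).neg
    · rw [hm', dotProduct_single_one, single_one_dotProduct, Matrix.neg_mulVec,
        Matrix.smul_mulVec]
      change ħ⁻¹ * _ + -(ħ⁻¹ * _) = ħ⁻¹ * _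
      rw [← mul_neg, ← mul_add, ← sub_eq_add_neg]
      rfl
  have hħ' : (ħ : ℂ) ≠ 0 := Complex.ofReal_ne_zero.2 hħ.ne'
  have hπ : (Real.pi : ℂ) ≠ 0 := Complex.ofReal_ne_zero.2 Real.pi_ne_zero
  have hmain := lineDeriv_quadFourier (c := c) (L := frequencyEquiv hħ hR)
    (hasTemperateGrowth_outerPhase S Pt Xt Xs (R := R) (ħ := ħ) Q₂)
    (hasTemperateGrowth_innerPhase (ħ := ħ) (R := R) Xt Ps Xs Q₁) ha' f
  have hin : ∀ y, inner ℝ y (frequencyEquiv hħ hR m) =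
      -(2 * Real.pi * ħ)⁻¹ * (R *ᵥ y.ofLp) j := fun y => by
    rw [frequencyEquiv_apply, inner_frequencyMap]
    simp [hm']
  have hin' : Function.HasTemperateGrowth fun y : EuclideanSpace ℝ (Fin n) =>
      ((inner ℝ y (frequencyEquiv hħ hR m) : ℝ) : ℂ) :=
    Complex.ofRealCLM.hasTemperateGrowth.comp (by fun_prop :
      (inner ℝ · (frequencyEquiv hħ hR m) : EuclideanSpace ℝ (Fin n) → ℝ).HasTemperateGrowth)
  have hvec : ∑ i, (R j i : ℂ) • dzSchwartz ħ zs (.inr i) f =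
      (-(2 * Real.pi * ħ : ℂ)) • SchwartzMap.smulLeftCLM ℂ
        (fun y => ((inner ℝ y (frequencyEquiv hħ hR m) : ℝ) : ℂ)) f - ((R *ᵥ Xs) j : ℂ) • f := by
    ext y
    simp only [_root_.sub_apply, _root_.sum_apply, _root_.smul_apply,
      dzSchwartz_inr_apply, smul_eq_mul, SchwartzMap.smulLeftCLM_apply_apply hin']
    rw [hin]
    have h1 : ∑ i, (R j i : ℂ) * ((y i : ℂ) - zs (.inr i)) =
        ((R *ᵥ y.ofLp) j : ℝ) - ((R *ᵥ Xs) j : ℝ) := by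
      simp only [Matrix.mulVec, dotProduct, Xs]
      push_cast
      rw [← Finset.sum_sub_distrib]
      exact Finset.sum_congr rfl fun i _ => by ring
    simp only [← mul_assoc, ← Finset.sum_mul, h1]
    push_cast
    field_simp
  have hT := congrArg (fun u => T u x) hvec
  simp only [map_sub, map_sum, map_smul, _root_.sub_apply, _root_.sum_apply,
    _root_.smul_apply, smul_eq_mul] at hT
  rw [hT, dzSchwartz_inl_apply, ← hm, hmain]
  simp only [dzSchwartz_inr_apply, ← mul_assoc, ← Finset.sum_mul]
  have ha : (ħ : ℂ) * a' = (zt (.inl j) : ℂ) - ((R *ᵥ Xs) j : ℝ) -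
      ∑ i, (Q₂ j i : ℂ) * ((x i : ℂ) - zt (.inr i)) := by
    simp only [ha'_def]
    push_cast
    rw [mul_inv_cancel_left₀ hħ']
  linear_combination T f x * ha + (2 * Real.pi * ħ * T (SchwartzMap.smulLeftCLM ℂ
    (fun y => ((inner ℝ y (frequencyEquiv hħ hR m) : ℝ) : ℂ)) f) x - ħ * a' * T f x) *
      Complex.I_sq

end Kernel

end CanonicalOperators

open scoped SchwartzMap

variable {n : ℕ}

/-! ### The integral operator with the Green function -/

lemma lam3_inv_det_ne_zero {D : Coeffs n} {κt t s : ℝ} (hdet : (lam3 D κt t s).det ≠ 0) :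
    ((lam3 D κt t s)⁻¹).det ≠ 0 := by
  rw [Matrix.det_nonsing_inv, Ring.inverse_eq_inv']
  exact inv_ne_zero hdet

lemma lam1_mul_inv_isSymm {D : Coeffs n} {κt t s : ℝ} (hdet : (lam3 D κt t s).det ≠ 0) :
    (lam1 D κt t s * (lam3 D κt t s)⁻¹).IsSymm := by
  have hu : IsUnit (lam3 D κt t s).det := isUnit_iff_ne_zero.2 hdet
  have hu' : IsUnit ((lam3 D κt t s)ᵀ).det := by rwa [Matrix.det_transpose]
  have h := (lam_mul D κt t s).2.2
  rw [Matrix.IsSymm, Matrix.transpose_mul, Matrix.transpose_nonsing_inv]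
  calc ((lam3 D κt t s)ᵀ)⁻¹ * (lam1 D κt t s)ᵀ
      = ((lam3 D κt t s)ᵀ)⁻¹ * ((lam1 D κt t s)ᵀ * lam3 D κt t s) * (lam3 D κt t s)⁻¹ := by
        rw [Matrix.mul_assoc, Matrix.mul_nonsing_inv_cancel_right _ _ hu]
    _ = _ := by rw [← h, Matrix.nonsing_inv_mul_cancel_left _ _ hu']

lemma inv_mul_lam4_isSymm {D : Coeffs n} {κt t s : ℝ} (hdet : (lam3 D κt t s).det ≠ 0) :
    ((lam3 D κt t s)⁻¹ * lam4 D κt t s).IsSymm := by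
  have hu : IsUnit (lam3 D κt t s).det := isUnit_iff_ne_zero.2 hdet
  have hu' : IsUnit ((lam3 D κt t s)ᵀ).det := by rwa [Matrix.det_transpose]
  have h := (lam_mul D κt t s).2.1
  rw [Matrix.IsSymm, Matrix.transpose_mul, Matrix.transpose_nonsing_inv]
  calc (lam4 D κt t s)ᵀ * ((lam3 D κt t s)ᵀ)⁻¹
      = (lam3 D κt t s)⁻¹ * (lam3 D κt t s * (lam4 D κt t s)ᵀ) * ((lam3 D κt t s)ᵀ)⁻¹ := by
        rw [Matrix.nonsing_inv_mul_cancel_left _ _ hu]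
    _ = _ := by rw [← h, Matrix.mul_assoc, Matrix.mul_nonsing_inv_cancel_right _ _ hu']

section GreenOperator

variable (D : Coeffs n) {ħ : ℝ} (hħ : 0 < ħ) (κt : ℝ) (g : ℝ → PhaseVec n × PhaseMat n) {t s : ℝ}
  (hdet : (lam3 D κt t s).det ≠ 0)

/-- The operator with kernel `green D ħ κt g t s` on Schwartz functions. -/
noncomputable def greenOp : 𝓢(EuclideanSpace ℝ (Fin n), ℂ) →L[ℂ] 𝓢(EuclideanSpace ℝ (Fin n), ℂ) :=
  quadFourier (1 / sqrtDet D ħ κt t s)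
    (outerPhase ħ (action D κt g t - action D κt g s) (fun i => (g t).1 (.inl i))
      (fun i => (g t).1 (.inr i)) (fun i => (g s).1 (.inr i)) (lam3 D κt t s)⁻¹
      ((lam3 D κt t s)⁻¹ * lam4 D κt t s))
    (innerPhase ħ (fun i => (g t).1 (.inr i)) (fun i => (g s).1 (.inl i))
      (fun i => (g s).1 (.inr i)) (lam3 D κt t s)⁻¹ (lam1 D κt t s * (lam3 D κt t s)⁻¹))
    (frequencyEquiv hħ (lam3_inv_det_ne_zero hdet))

lemma greenPhase_eq (x y : EuclideanSpace ℝ (Fin n)) :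
    outerPhase ħ (action D κt g t - action D κt g s) (fun i => (g t).1 (.inl i))
      (fun i => (g t).1 (.inr i)) (fun i => (g s).1 (.inr i)) (lam3 D κt t s)⁻¹
      ((lam3 D κt t s)⁻¹ * lam4 D κt t s) x +
    innerPhase ħ (fun i => (g t).1 (.inr i)) (fun i => (g s).1 (.inl i))
      (fun i => (g s).1 (.inr i)) (lam3 D κt t s)⁻¹ (lam1 D κt t s * (lam3 D κt t s)⁻¹) y -
    2 * Real.pi * inner ℝ y (frequencyEquiv hħ (lam3_inv_det_ne_zero hdet) x) =
    ħ⁻¹ * greenPhase D κt g t s x y :=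
  outerPhase_add_innerPhase _ _ _ _ _ _ _ hħ _ x y

lemma greenOp_apply (f : 𝓢(EuclideanSpace ℝ (Fin n), ℂ)) (x : EuclideanSpace ℝ (Fin n)) :
    greenOp D hħ κt g hdet f x = ∫ y, green D ħ κt g t s x y * f y := by
  rw [greenOp, quadFourier_eq_integral (hasTemperateGrowth_outerPhase _ _ _ _ _)
    (hasTemperateGrowth_innerPhase _ _ _ _)]
  refine integral_congr_ae (Eventually.of_forall fun y => ?_)
  beta_reduce
  rw [greenPhase_eq D hħ κt g hdet x y, green]
  congr 3
  push_cast
  ring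

lemma norm_sq_inv_sqrtDet : ‖1 / sqrtDet D ħ κt t s‖ ^ 2 =
    |LinearMap.det (frequencyEquiv hħ (lam3_inv_det_ne_zero hdet) :
      EuclideanSpace ℝ (Fin n) →ₗ[ℝ] _)| := by
  have h2 : (0 : ℝ) < 2 * Real.pi * ħ := by positivity
  rw [det_frequencyEquiv, norm_div, div_pow, norm_sqrtDet_sq D hħ κt t s hdet, abs_mul, abs_pow,
    abs_neg, abs_inv, abs_of_pos h2, Matrix.det_nonsing_inv, Ring.inverse_eq_inv', abs_inv]
  rw [norm_one, one_pow, one_div, mul_inv, inv_pow]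

lemma integral_star_greenOp_mul (f h : 𝓢(EuclideanSpace ℝ (Fin n), ℂ)) :
    ∫ x, star (greenOp D hħ κt g hdet f x) * greenOp D hħ κt g hdet h x =
      ∫ x, star (f x) * h x :=
  integral_star_quadFourier_mul (hasTemperateGrowth_outerPhase _ _ _ _ _)
    (hasTemperateGrowth_innerPhase _ _ _ _) (norm_sq_inv_sqrtDet D hħ κt hdet) f h

/-- Exchanging the times replaces λ₃⁻¹ by its negative transpose. By the symmetry of λ₁λ₃⁻¹ and
λ₃⁻¹λ₄, the two diagonal forms trade places with opposite sign. -/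
lemma greenPhase_swap (hdet : (lam3 D κt t s).det ≠ 0) (x y : EuclideanSpace ℝ (Fin n)) :
    greenPhase D κt g s t x y = -greenPhase D κt g t s y x := by
  have hu : IsUnit (lam3 D κt t s).det := isUnit_iff_ne_zero.2 hdet
  have hinv : (lam3 D κt s t)⁻¹ = -((lam3 D κt t s)⁻¹)ᵀ := by
    rw [lam3_swap]
    refine Matrix.inv_eq_right_inv ?_
    rw [_root_.neg_mul_neg, ← Matrix.transpose_mul, Matrix.nonsing_inv_mul _ hu,
      Matrix.transpose_one]
  have h1 : lam1 D κt s t * (lam3 D κt s t)⁻¹ = -((lam3 D κt t s)⁻¹ * lam4 D κt t s) := by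
    rw [hinv, lam1_swap, Matrix.mul_neg, ← Matrix.transpose_mul, (inv_mul_lam4_isSymm hdet).eq]
  have h2 : (lam3 D κt s t)⁻¹ * lam4 D κt s t = -(lam1 D κt t s * (lam3 D κt t s)⁻¹) := by
    rw [hinv, lam4_swap, Matrix.neg_mul, ← Matrix.transpose_mul, (lam1_mul_inv_isSymm hdet).eq]
  simp only [greenPhase]
  rw [h1, h2, hinv]
  simp only [Matrix.neg_mulVec, dotProduct_neg, Matrix.mulVec_transpose]
  rw [dotProduct_comm (fun j => x j - (g s).1 (.inr j)) (_ ᵥ* _), ← Matrix.dotProduct_mulVec]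
  ring

lemma green_swap (hħ : 0 < ħ) (hdet : (lam3 D κt t s).det ≠ 0) (x y : EuclideanSpace ℝ (Fin n)) :
    green D ħ κt g s t x y = star (1 / sqrtDet D ħ κt t s) *
      Complex.exp (-(Complex.I * ((ħ⁻¹ * greenPhase D κt g t s y x : ℝ) : ℂ))) := by
  rw [green, sqrtDet_swap D hħ κt t s hdet, greenPhase_swap D κt g hdet x y]
  simp only [star_div₀, star_one]
  congr 2
  push_cast
  ring

lemma integral_green_swap_mul_greenOp (f : 𝓢(EuclideanSpace ℝ (Fin n), ℂ))
    (x : EuclideanSpace ℝ (Fin n)) :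
    ∫ y, green D ħ κt g s t x y * greenOp D hħ κt g hdet f y = f x := by
  have h := integral_adjoint_quadFourier (c := 1 / sqrtDet D ħ κt t s)
    (hasTemperateGrowth_outerPhase (ħ := ħ) (action D κt g t - action D κt g s)
      (fun i => (g t).1 (.inl i)) (fun i => (g t).1 (.inr i)) (fun i => (g s).1 (.inr i))
      (R := (lam3 D κt t s)⁻¹) ((lam3 D κt t s)⁻¹ * lam4 D κt t s))
    (hasTemperateGrowth_innerPhase (ħ := ħ) (fun i => (g t).1 (.inr i))
      (fun i => (g s).1 (.inl i)) (fun i => (g s).1 (.inr i)) (R := (lam3 D κt t s)⁻¹)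
      (lam1 D κt t s * (lam3 D κt t s)⁻¹)) (norm_sq_inv_sqrtDet D hħ κt hdet) f x
  rw [← h]
  refine integral_congr_ae (Eventually.of_forall fun y => ?_)
  beta_reduce
  rw [greenPhase_eq D hħ κt g hdet y x, green_swap D κt g hħ hdet x y]
  rfl

/-- The operators `ẑ - z(t)` and `ẑ - z(s)` are intertwined by the symplectic matrix
`𝒜(t, s)`. -/
lemma dzSchwartz_greenOp (f : 𝓢(EuclideanSpace ℝ (Fin n), ℂ)) (k : Fin n ⊕ Fin n) :
    dzSchwartz ħ (g t).1 k (greenOp D hħ κt g hdet f) = greenOp D hħ κt g hdet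
      (∑ l, (matricant D κt t s k l : ℂ) • dzSchwartz ħ (g s).1 l f) := by
  ext x
  set T := greenOp D hħ κt g hdet
  have hu : IsUnit (lam3 D κt t s).det := isUnit_iff_ne_zero.2 hdet
  have hR := lam3_inv_det_ne_zero hdet
  obtain ⟨hs1, hs2, hs3⟩ := lam_mul D κt t s
  set A1 := lam1 D κt t s with hA1
  set A2 := lam2 D κt t s with hA2
  set A3 := lam3 D κt t s with hA3
  set A4 := lam4 D κt t s with hA4
  set U : Fin n → ℂ := fun i => dzSchwartz ħ (g t).1 (.inr i) (T f) x with hU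
  set P : Fin n → ℂ := fun i => dzSchwartz ħ (g t).1 (.inl i) (T f) x with hP
  set V : Fin n → ℂ := fun i => T (dzSchwartz ħ (g s).1 (.inr i) f) x with hV
  set W : Fin n → ℂ := fun i => T (dzSchwartz ħ (g s).1 (.inl i) f) x with hW
  let cast : Matrix (Fin n) (Fin n) ℝ → Matrix (Fin n) (Fin n) ℂ := fun M => M.map Complex.ofReal
  have cmul : ∀ M N, cast M * cast N = cast (M * N) := fun M N =>
    (Matrix.map_mul (f := Complex.ofRealHom)).symm
  have e1 : (cast A3⁻¹)ᵀ *ᵥ U = cast (A1 * A3⁻¹) *ᵥ V - W := funext fun j =>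
    sum_smul_dzSchwartz_inr (c := 1 / sqrtDet D ħ κt t s) (action D κt g t - action D κt g s)
      hħ hR (lam1_mul_inv_isSymm hdet) (zt := (g t).1) (zs := (g s).1) f j x
  have e2 : P = -(cast (A3⁻¹ * A4) *ᵥ U) + cast A3⁻¹ *ᵥ V := funext fun j =>
    dzSchwartz_inl_quadFourier (c := 1 / sqrtDet D ħ κt t s) (action D κt g t - action D κt g s)
      hħ hR (inv_mul_lam4_isSymm hdet) (zt := (g t).1) (zs := (g s).1) f j x
  -- Applying λ₃ᵀ to `e1` and using λ₃ᵀλ₁ = λ₁ᵀλ₃ yields the lower row of 𝒜(t, s).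
  have e3 : U = cast A1ᵀ *ᵥ V - cast A3ᵀ *ᵥ W := by
    have h := congrArg (fun v => cast A3ᵀ *ᵥ v) e1
    simp only [Matrix.mulVec_sub, Matrix.mulVec_mulVec] at h
    have h1 : cast A3ᵀ * (cast A3⁻¹)ᵀ = 1 := by
      have : (cast A3⁻¹)ᵀ = cast (A3⁻¹)ᵀ := rfl
      rw [this, cmul, ← Matrix.transpose_mul, Matrix.nonsing_inv_mul _ hu]
      simp [cast]
    rw [h1, cmul, ← Matrix.mul_assoc, hs3, Matrix.mul_assoc, Matrix.mul_nonsing_inv _ hu,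
      Matrix.mul_one, Matrix.one_mulVec] at h
    exact h
  -- Inserting `e3` into `e2`, the remaining two symplectic relations yield the upper row.
  have e4 : P = cast A4ᵀ *ᵥ W + cast (-A2ᵀ) *ᵥ V := by
    have h1 : A3⁻¹ * A4 * A3ᵀ = A4ᵀ := by
      rw [Matrix.mul_assoc, hs2, Matrix.nonsing_inv_mul_cancel_left _ _ hu]
    have h2 : A3⁻¹ = A3⁻¹ * A4 * A1ᵀ + -A2ᵀ := by
      have h := congrArg (fun M => A3⁻¹ * M) hs1
      simp only [Matrix.mul_sub, Matrix.mul_one, Matrix.nonsing_inv_mul_cancel_left _ _ hu] at h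
      rw [Matrix.mul_assoc, ← sub_eq_add_neg]
      exact h.symm
    have cadd : ∀ M N, cast (M + N) = cast M + cast N := fun M N => by
      ext i j; simp [cast]
    rw [e2, e3, Matrix.mulVec_sub, Matrix.mulVec_mulVec, Matrix.mulVec_mulVec, cmul, cmul, h1]
    conv_lhs => rw [h2, cadd, Matrix.add_mulVec, ← h2]
    abel
  have hT : T (∑ l, (matricant D κt t s k l : ℂ) • dzSchwartz ħ (g s).1 l f) x =
      ∑ l, (matricant D κt t s k l : ℂ) * T (dzSchwartz ħ (g s).1 l f) x := by
    simp only [map_sum, map_smul, _root_.sum_apply, _root_.smul_apply, smul_eq_mul]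
  rw [hT, Fintype.sum_sum_type, matricant_eq_fromBlocks]
  rcases k with k | k
  · refine (congrFun e4 k).trans ?_
    simp [Matrix.mulVec, dotProduct, cast, hV, hW, hA4, hA2]
  · refine (congrFun e3 k).trans ?_
    simp [Matrix.mulVec, dotProduct, cast, hV, hW, hA1, hA3]
    ring

end GreenOperator

/-! ### Moments -/

/-- `⟨f, h⟩` in `L²`, linear in `h`. -/
noncomputable def pairing (f : 𝓢(EuclideanSpace ℝ (Fin n), ℂ)) :
    𝓢(EuclideanSpace ℝ (Fin n), ℂ) →L[ℂ] ℂ :=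
  innerSL ℂ (f.toLp 2 volume) ∘L SchwartzMap.toLpCLM ℂ ℂ 2 volume

lemma pairing_apply (f h : 𝓢(EuclideanSpace ℝ (Fin n), ℂ)) :
    pairing f h = ∫ x, star (f x) * h x := by
  simp [pairing, RCLike.inner_apply, mul_comm]

lemma normSq_eq (f : 𝓢(EuclideanSpace ℝ (Fin n), ℂ)) : (normSq f : ℂ) = pairing f f := by
  rw [pairing_apply, normSq, ← integral_complex_ofReal]
  refine integral_congr_ae (Eventually.of_forall fun x => ?_)
  simp [Complex.conj_mul']

lemma eq_zero_of_normSq_eq_zero {f : 𝓢(EuclideanSpace ℝ (Fin n), ℂ)} (h : normSq f = 0) :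
    f = 0 := by
  have h1 : pairing f f = 0 := by rw [← normSq_eq, h, Complex.ofReal_zero]
  have h2 : inner ℂ (f.toLp 2 (volume : Measure (EuclideanSpace ℝ (Fin n))))
    (f.toLp 2 volume) = 0 := h1
  rw [inner_self_eq_zero] at h2
  exact SchwartzMap.injective_toLp 2 volume (h2.trans (SchwartzMap.toLpCLM ℂ ℂ 2 volume).map_zero.symm)

lemma mean_eq {A : (EuclideanSpace ℝ (Fin n) → ℂ) → EuclideanSpace ℝ (Fin n) → ℂ}
    {f h : 𝓢(EuclideanSpace ℝ (Fin n), ℂ)} (hA : A f = h) :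
    mean A f = (pairing f h).re / normSq f := by
  rw [mean, hA, pairing_apply]

lemma pairing_dzSchwartz_re {f : 𝓢(EuclideanSpace ℝ (Fin n), ℂ)} (hf : normSq f ≠ 0) (ħ : ℝ)
    (z : PhaseVec n) (k : Fin n ⊕ Fin n) :
    (pairing f (dzSchwartz ħ z k f)).re = normSq f * (zMean ħ f k - z k) := by
  have h0 : zOp ħ k f = ⇑(dzSchwartz ħ 0 k f) := by
    rw [coe_dzSchwartz]
    funext x
    simp [dzOp]
  have h1 : dzSchwartz ħ z k f = dzSchwartz ħ 0 k f - (z k : ℂ) • f := by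
    rcases k with k | k <;> simp [dzSchwartz]
  rw [zMean, mean_eq h0, h1, map_sub, map_smul, ← normSq_eq, Complex.sub_re, smul_eq_mul,
    ← Complex.ofReal_mul, Complex.ofReal_re]
  field_simp

/-- The matrix `Re⟨f, (ẑ_j - z_j)(ẑ_k - z_k) f⟩`. -/
noncomputable def secondMoments (ħ : ℝ) (z : PhaseVec n) (f : 𝓢(EuclideanSpace ℝ (Fin n), ℂ)) :
    PhaseMat n :=
  Matrix.of fun j k => (pairing f (dzSchwartz ħ z j (dzSchwartz ħ z k f))).re

/-- Keeping the symmetrization explicit avoids any appeal to self-adjointness of ẑ: a congruence by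
a real matrix commutes with transposition. -/
lemma covMean_eq (ħ : ℝ) (f : 𝓢(EuclideanSpace ℝ (Fin n), ℂ)) :
    covMean ħ f = (2 * normSq f)⁻¹ • (secondMoments ħ (zMean ħ f) f +
      (secondMoments ħ (zMean ħ f) f)ᵀ) := by
  ext j k
  have h : (fun x => dzOp ħ (zMean ħ f) j (dzOp ħ (zMean ħ f) k f) x +
      dzOp ħ (zMean ħ f) k (dzOp ħ (zMean ħ f) j f) x) =
      ⇑(dzSchwartz ħ (zMean ħ f) j (dzSchwartz ħ (zMean ħ f) k f) +
        dzSchwartz ħ (zMean ħ f) k (dzSchwartz ħ (zMean ħ f) j f)) := by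
    funext x
    simp only [_root_.add_apply, coe_dzSchwartz]
  rw [covMean, Matrix.of_apply, mean_eq (h := dzSchwartz ħ (zMean ħ f) j
    (dzSchwartz ħ (zMean ħ f) k f) + dzSchwartz ħ (zMean ħ f) k
      (dzSchwartz ħ (zMean ħ f) j f)) h, map_add, Complex.add_re]
  simp only [Matrix.smul_apply, Matrix.add_apply, Matrix.transpose_apply, secondMoments,
    Matrix.of_apply, smul_eq_mul, mul_inv]
  ring

/-! ### Transport of the norm and of the moments by the Green operator. -/

section

variable (D : Coeffs n) {ħ : ℝ} (hħ : 0 < ħ) (κt : ℝ) (g : ℝ → PhaseVec n × PhaseMat n) {t s : ℝ}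
  (hdet : (lam3 D κt t s).det ≠ 0) {f : 𝓢(EuclideanSpace ℝ (Fin n), ℂ)}

lemma pairing_greenOp (f h : 𝓢(EuclideanSpace ℝ (Fin n), ℂ)) :
    pairing (greenOp D hħ κt g hdet f) (greenOp D hħ κt g hdet h) = pairing f h := by
  rw [pairing_apply, pairing_apply, integral_star_greenOp_mul]

lemma normSq_greenOp (f : 𝓢(EuclideanSpace ℝ (Fin n), ℂ)) :
    normSq (greenOp D hħ κt g hdet f) = normSq f := by
  have : (normSq (greenOp D hħ κt g hdet f) : ℂ) = normSq f := by
    rw [normSq_eq, normSq_eq, pairing_greenOp]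
  exact_mod_cast this

/-- By the intertwining relation and isometry, the mean of ẑ - z(t) in the image is a real
combination of the means of ẑ - z(s) in f, which vanish. The differential equation for z plays no
role, since z(t) is built into the kernel. -/
lemma zMean_greenOp (hf : normSq f ≠ 0) (hz : (g s).1 = zMean ħ f) :
    zMean ħ (greenOp D hħ κt g hdet f) = (g t).1 := by
  funext k
  have hN := normSq_greenOp D hħ κt g hdet f
  have h := pairing_dzSchwartz_re (by rwa [hN]) ħ (g t).1 k
    (f := greenOp D hħ κt g hdet f)
  rw [dzSchwartz_greenOp, pairing_greenOp, map_sum, Complex.re_sum, hN] at h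
  have h0 : ∑ l, (pairing f ((matricant D κt t s k l : ℂ) • dzSchwartz ħ (g s).1 l f)).re = 0 :=
    Finset.sum_eq_zero fun l _ => by
      rw [map_smul, smul_eq_mul, Complex.re_ofReal_mul, pairing_dzSchwartz_re hf, hz, sub_self,
        mul_zero, mul_zero]
  rw [h0] at h
  exact sub_eq_zero.1 ((mul_eq_zero.1 h.symm).resolve_left hf)

/-- The intertwining relation is used twice; 𝒜 is real and passes through the real part. -/
lemma secondMoments_greenOp (f : 𝓢(EuclideanSpace ℝ (Fin n), ℂ)) :
    secondMoments ħ (g t).1 (greenOp D hħ κt g hdet f) =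
      matricant D κt t s * secondMoments ħ (g s).1 f * (matricant D κt t s)ᵀ := by
  ext j k
  simp only [secondMoments, Matrix.of_apply, Matrix.mul_apply, Matrix.transpose_apply,
    dzSchwartz_greenOp, pairing_greenOp, map_sum, map_smul, smul_eq_mul, Complex.re_sum,
    Complex.re_ofReal_mul, Finset.sum_mul, Finset.smul_sum]
  refine Finset.sum_congr rfl fun l _ => Finset.sum_congr rfl fun m _ => ?_
  ring

lemma moments_greenOp (hf : normSq f ≠ 0) (hz : (g s).1 = zMean ħ f) :
    moments ħ (greenOp D hħ κt g hdet f) =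
      ((g t).1, matricant D κt t s * covMean ħ f * (matricant D κt t s)ᵀ) := by
  have h1 := zMean_greenOp D hħ κt g hdet hf hz
  rw [moments, covMean_eq, covMean_eq, h1, normSq_greenOp, secondMoments_greenOp, hz]
  simp only [Matrix.transpose_mul, Matrix.transpose_transpose, Matrix.mul_smul, Matrix.smul_mul,
    Matrix.mul_add, Matrix.add_mul, Matrix.mul_assoc]

end

/-- Trajectory concentrated functions are Schwartz functions. -/
lemma exists_schwartz_of_mem_tcfClass {ħ : ℝ} (hħ : 0 < ħ) {ψ : EuclideanSpace ℝ (Fin n) → ℂ}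
    (hψ : ψ ∈ tcfClass n ħ) : ∃ f : 𝓢(EuclideanSpace ℝ (Fin n), ℂ), ⇑f = ψ := by
  obtain ⟨S₀, P₀, X₀, φ₀, h⟩ := hψ
  have hc : (Real.sqrt ħ)⁻¹ ≠ 0 := inv_ne_zero (Real.sqrt_pos.2 hħ).ne'
  set q : EuclideanSpace ℝ (Fin n) → ℝ := fun x => ħ⁻¹ * (S₀ + inner ℝ P₀ (x - X₀))
  have hq : q.HasTemperateGrowth := by
    have h1 : Function.HasTemperateGrowth fun x : EuclideanSpace ℝ (Fin n) =>
        inner ℝ P₀ (x - X₀) := by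
      simp only [inner_sub_right]
      exact (Function.hasTemperateGrowth_inner_right P₀).sub (.const _)
    exact (Function.HasTemperateGrowth.const ħ⁻¹).mul
      ((Function.HasTemperateGrowth.const S₀).add h1)
  refine ⟨SchwartzMap.smulLeftCLM ℂ (phaseFactor q) (SchwartzMap.compSubConstCLM ℂ X₀
    (SchwartzMap.compCLMOfContinuousLinearEquiv ℂ
      (ContinuousLinearEquiv.smulLeft (Units.mk0 _ hc)) φ₀)), ?_⟩
  funext x
  rw [SchwartzMap.smulLeftCLM_apply_apply (hasTemperateGrowth_phaseFactor hq), h x, phaseFactor,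
    smul_eq_mul]
  congr 1
  · congr 1
    simp only [q]
    push_cast
    ring

end NonlocalGPE

/-! ### The left inverse. -/

theorem mainTheorem3 {n : ℕ} (D : NonlocalGPE.Coeffs n) (ħ κ : ℝ) (hħ : 0 < ħ) (t s : ℝ)
    (ψ : EuclideanSpace ℝ (Fin n) → ℂ) (hψ : ψ ∈ NonlocalGPE.tcfClass n ħ)
    (hdet : t ≠ s → (NonlocalGPE.lam3 D (κ * NonlocalGPE.normSq ψ) t s).det ≠ 0)
    (x : EuclideanSpace ℝ (Fin n)) :
    NonlocalGPE.evolutionInv D ħ κ t s (NonlocalGPE.evolution D ħ κ t s ψ) x = ψ x := by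
  open NonlocalGPE in
  rcases eq_or_ne t s with rfl | hts
  · simp [evolutionInv, evolution]
  obtain ⟨f, rfl⟩ := exists_schwartz_of_mem_tcfClass hħ hψ
  have hdet := hdet hts
  set κt := κ * normSq f with hκt
  set g := trajectory D ħ κ s f with hg
  have hev : evolution D ħ κ t s f = ⇑(greenOp D hħ κt g hdet f) := by
    funext x
    rw [greenOp_apply, evolution, if_neg hts]
  -- For ψ = 0 the moments are 0 by the convention for division and need not be carried along the
  -- trajectory, but linearity of the integral in ψ makes both operators send 0 to 0.
  rcases eq_or_ne (normSq f) 0 with hf | hf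
  · obtain rfl := eq_zero_of_normSq_eq_zero hf
    rw [hev, map_zero]
    simp [evolutionInv, hts]
  · obtain ⟨hsol, hgs⟩ := hesSolution_spec (D := D) (κt := κt) s (moments ħ f)
    have hmom : moments ħ (greenOp D hħ κt g hdet f) = g t := by
      rw [moments_greenOp D hħ κt g hdet hf (congrArg Prod.fst hgs)]
      exact Prod.ext rfl (hesSolution_snd s t (moments ħ f)).symm
    have hN := normSq_greenOp D hħ κt g hdet f
    -- The nonlinear point: the backward operator, which sees only the evolved function, finds the
    -- same parameter and the same trajectory.
    have htraj : trajectory D ħ κ t (greenOp D hħ κt g hdet f) = g := by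
      rw [trajectory, hN, hmom]
      exact hesSolution_eq_of_isHESSolution hsol t
    rw [hev, evolutionInv, if_neg hts, htraj, hN]
    exact integral_green_swap_mul_greenOp D hħ κt g hdet f x
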